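/- **Setting.** Let $G=(V,E)$ be a finite connected simple $4$-regular graph. A *dart* is a pair $(v,e)$ with $v\in V$, $e\in E$ incident with $v$. The *dart graph* $\mathcal D(G)$ has the darts as vertices, two distinct darts being adjacent iff they have the same vertex or the same edge; an edge $e=vw\in E$ is identified with the edge $\{(v,e),(w,e)\}$ of $\mathcal D(G)$. An *incidence matrix* is an antisymmetric complex matrix $A$ indexed by the darts with $A_{d,d'}=0$ whenever $d,d'$ are not adjacent in $\mathcal D(G)$. $\mathcal C(G)$ is the set of closed curves, i.e. of all $C\subseteq E$ containing an even number of edges at every vertex. $\triangle$ denotes symmetric difference. Fix an arbitrary enumeration $e_v^1,e_v^2,e_v^3,e_v^4$ of the set $E(v)$ of edges at each vertex $v$, let $d_1,d_2,\dots,d_{2n}$ ($n=2|V|$) be the induced lexicographic enumeration of the darts, and let $M_0=\bigcup_v\{\{(v,e_v^1),(v,e_v^2)\},\{(v,e_v^3),(v,e_v^4)\}\}$. For $C\in\mathcal C(G)$ put $$F_A(M_0,C)=\sum_{M}\frac1{2^n n!}\sum_{\sigma}\operatorname{sgn}(\sigma)\,A_{\sigma(d_1),\sigma(d_2)}\cdots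 A_{\sigma(d_{2n-1}),\sigma(d_{2n})},$$ where $M$ runs over the perfect matchings of $\mathcal D(G)$ with $(M_0\triangle M)\cap E=C$ and $\sigma$ over the permutations of the darts with $\{\{\sigma(d_1),\sigma(d_2)\},\dots,\{\sigma(d_{2n-1}),\sigma(d_{2n})\}\}=M$. Let $\gamma$ be a cycle of $G$ with cyclically ordered vertices $v_i$ and edges $e_i$ ($i\in\mathbb Z/r$, $e_i=v_iv_{i+1}$). For each $i$ let $\sigma_i$ be the unique even permutation of $E(v_i)$ with $\sigma_i(e^1_{v_i})=e_{i-1}$ and $\sigma_i(e^4_{v_i})=e_i$, write $a^i_{jk}=A_{(v_i,\sigma_i(e_{v_i}^j)),(v_i,\sigma_i(e_{v_i}^k))}$, and set $$S_i=a^i_{12},\quad \bar S_i=a^i_{34},\quad T_i=a^i_{13},\quad \bar T_i=a^i_{42},\quad U_i=a^i_{14},\quad B_i=A_{(v_i,e_i),(v_{i+1},e_i)} .$$ We say that $A$ *solves the cycle equations of* $\gamma$ if all $B_i$ and all entries $A_{(v_i,e),(v_i,f)}$ with $e\ne f$ are nonzero and, for all $i$, $$S_i\bar S_i+T_i\bar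 T_i=0,\qquad B_i^2=-\frac{U_i\bar T_i}{S_i}\,\frac{U_{i+1}T_{i+1}}{\bar S_{i+1}},\qquad \prod_i B_i=-\prod_i U_i .$$ (This does not depend on the chosen cyclic ordering of $\gamma$.) Let $G$ be strongly $2$-cell embedded in a closed surface, i.e. every face boundary is a cycle of $G$, and let the embedding be given by the embedding scheme $(\Pi,\lambda)$: $\Pi=(\pi_v)_{v\in V}$ with $\pi_v$ a cyclic permutation of $E(v)$, and $\lambda:E\to\{1,-1\}$. Faces are traced by the usual rule: one follows $\pi$ or $\pi^{-1}$ at the vertices, switching between the two each time an edge with $\lambda(e)=-1$ is traversed. Let $\mathcal F_0(G)$ be the family of the face boundaries and $\mathcal F_0^*(G)$ a maximal free subfamily (that is, maximal linearly independent over $\mathbb F_2$ in $(\mathcal C(G),\triangle)$; it is obtained by dropping one element of $\mathcal F_0(G)$). The embedding is *orientable* if, after reversing $\pi_v$ at the vertices $v$ of some subset of $V$ and changing the sign of $\lambda(e)$ once for each end of $e$ in this subset, one gets an embedding scheme with $\lambda\equiv1$. **Lemma.** 1. There is an incidence matrix $A$ which solves the cycle equations of every $\gamma\in\mathcal F_0^*(G)$,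 whose entries satisfy $A_{(v,e),(w,f)}\in i\mathbb R$ if $e=f$ and $\lambda(e)=-1$, and $A_{(v,e),(w,f)}\in\mathbb R$ otherwise, and such that $$F_A(M_0,C)=F_A(M_0,C\triangle\gamma)\qquad\text{for all }C\in\mathcal C(G),\ \gamma\in\mathcal F_0^*(G).\tag{$*$}$$ 2. There is an incidence matrix with all entries real which solves the cycle equations of every $\gamma\in\mathcal F_0^*(G)$ and satisfies $(*)$ if and only if the embedding is orientable. -/

import Mathlib

/-- The edge of a dart, as an element of the edge set.  A dart `(v, e)` (a vertex together with an
edge incident with it) is represented by Mathlib's `G.Dart`: `d.fst` is `v`, `d.edge` is `e`, and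
`d.symm` is the other dart on the same edge. -/
def dartEdge {V : Type*} {G : SimpleGraph V} (d : G.Dart) : G.edgeSet :=
  ⟨d.edge, d.edge_mem⟩

/-- The dart graph: its vertices are the darts of `G`; two distinct darts are adjacent iff they have
the same vertex or the same edge. -/
def dartGraph {V : Type*} (G : SimpleGraph V) : SimpleGraph G.Dart where
  Adj d d' := d ≠ d' ∧ (d.fst = d'.fst ∨ d.edge = d'.edge)
  symm := ⟨fun _ _ h => ⟨h.1.symm, h.2.imp Eq.symm Eq.symm⟩⟩
  loopless := ⟨fun _ h => h.1 rfl⟩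

/-- Closed curves: sets of edges meeting every vertex an even number of times. -/
def IsClosedCurve {V : Type*} (G : SimpleGraph V) (C : Set G.edgeSet) : Prop :=
  ∀ v : V, Even {d : G.Dart | d.fst = v ∧ dartEdge d ∈ C}.ncard

/-- Incidence matrices: antisymmetric complex matrices indexed by the darts, with zero entries
outside of the edges of the dart graph. -/
structure IsIncidenceMatrix {V : Type*} (G : SimpleGraph V) (A : Matrix G.Dart G.Dart ℂ) :
    Prop where
  antisymm : A.transpose = -A
  zero_of_not_adj : ∀ d d' : G.Dart, ¬ (dartGraph G).Adj d d' → A d d' = 0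

/-- An enumeration `e_v^1, e_v^2, e_v^3, e_v^4` of the four darts at every vertex `v`. -/
abbrev SiteOrder {V : Type*} (G : SimpleGraph V) : Type _ :=
  ∀ v : V, Fin 4 ≃ {d : G.Dart // d.fst = v}

/-! ### Perfect matchings of the dart graph and the Pfaffian weight of a closed curve -/

/-- `M` is a perfect matching of the dart graph. -/
def IsDartMatching {V : Type*} (G : SimpleGraph V) (M : Finset (Sym2 G.Dart)) : Prop :=
  (∀ p ∈ M, p ∈ (dartGraph G).edgeSet) ∧ ∀ d : G.Dart, ∃! p, p ∈ M ∧ d ∈ p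

/-- The set of pairs `{σ d₁, σ d₂}, {σ d₃, σ d₄}, …`, where `d₁, d₂, …` is the lexicographic
enumeration of the darts (vertex by vertex, the four darts at each vertex being enumerated by
`ord`).  The order in which the vertices come is irrelevant here. -/
def pairing {V : Type*} [Fintype V] [DecidableEq V] {G : SimpleGraph V}
    (ord : SiteOrder G) (σ : Equiv.Perm G.Dart) : Finset (Sym2 G.Dart) :=
  Finset.univ.biUnion fun v : V =>
    {s(σ (ord v 0), σ (ord v 1)), s(σ (ord v 2), σ (ord v 3))}

/-- The reference matching, made of the pairs `{(v, e_v^1), (v, e_v^2)}`, `{(v, e_v^3), (v, e_v^4)}`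
for all vertices `v`. -/
def refMatching {V : Type*} [Fintype V] [DecidableEq V] {G : SimpleGraph V}
    (ord : SiteOrder G) : Finset (Sym2 G.Dart) :=
  pairing ord 1

/-- The closed curve `(M₀ ∆ M) ∩ E` associated with a matching `M`, where an edge of `G` is
identified with the pair of its two darts. -/
def matchingCurve {V : Type*} [DecidableEq V] {G : SimpleGraph V}
    (M₀ M : Finset (Sym2 G.Dart)) : Set G.edgeSet :=
  {e | ∃ d : G.Dart, dartEdge d = e ∧ s(d, d.symm) ∈ symmDiff M₀ M}

/-- The product `A_{σ d₁, σ d₂} A_{σ d₃, σ d₄} ⋯`. -/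
def pairProduct {V : Type*} [Fintype V] {G : SimpleGraph V}
    (ord : SiteOrder G) (A : Matrix G.Dart G.Dart ℂ) (σ : Equiv.Perm G.Dart) : ℂ :=
  ∏ v : V, A (σ (ord v 0)) (σ (ord v 1)) * A (σ (ord v 2)) (σ (ord v 3))

open Classical in
/-- The contribution `F_A(M₀, C)` of the closed curve `C` to the Pfaffian of `A`:
the sum over the perfect matchings `M` mapped to `C` of
`1 / (2 ^ n * n!) * ∑ σ, sign σ * A_{σ d₁, σ d₂} A_{σ d₃, σ d₄} ⋯`, over the permutations `σ` whose
set of pairs is `M`.  The number of darts is `2 * n = 4 * |V|`. -/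
noncomputable def curveWeight {V : Type*} [Fintype V] [DecidableEq V]
    {G : SimpleGraph V} [DecidableRel G.Adj] (ord : SiteOrder G) (A : Matrix G.Dart G.Dart ℂ)
    (M₀ : Finset (Sym2 G.Dart)) (C : Set G.edgeSet) : ℂ :=
  ∑ M : Finset (Sym2 G.Dart) with IsDartMatching G M ∧ matchingCurve M₀ M = C,
    1 / (2 ^ (2 * Fintype.card V) * ((2 * Fintype.card V).factorial : ℂ)) *
      ∑ σ : Equiv.Perm G.Dart with pairing ord σ = M,
        ((Equiv.Perm.sign σ : ℤ) : ℂ) * pairProduct ord A σ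

/-! ### Embedding schemes -/

/-- An embedding scheme `(Π, λ)`: `rot` restricts at each vertex `v` to a cyclic permutation `π_v` of
the darts at `v`, and `sgn` is the signature `λ`. -/
structure EmbeddingScheme {V : Type*} (G : SimpleGraph V) where
  rot : Equiv.Perm G.Dart
  fst_rot : ∀ d, (rot d).fst = d.fst
  sameCycle_rot : ∀ d d' : G.Dart, d.fst = d'.fst → rot.SameCycle d d'
  sgn : G.edgeSet → ℤˣ

namespace EmbeddingScheme

variable {V : Type*} {G : SimpleGraph V}

/-- One step of face tracing.  The state `(d, s)` means: about to traverse the edge of `d` starting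
from `d.fst`, turning according to `π` if `s = 1` and according to `π⁻¹` if `s = -1`.  The sense `s`
is reversed when an edge of negative signature is traversed. -/
def faceStep (X : EmbeddingScheme G) (x : G.Dart × ℤˣ) : G.Dart × ℤˣ :=
  ((X.rot ^ ((x.2 * X.sgn (dartEdge x.1) : ℤˣ) : ℤ)) x.1.symm, x.2 * X.sgn (dartEdge x.1))

/-- The states met by the facial walk which starts in state `x`. -/
def facialWalk (X : EmbeddingScheme G) (x : G.Dart × ℤˣ) : Set (G.Dart × ℤˣ) :=
  Set.range fun n : ℕ => X.faceStep^[n] x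

/-- The edge set of the facial walk which starts in state `x`. -/
def faceBoundary (X : EmbeddingScheme G) (x : G.Dart × ℤˣ) : Set G.edgeSet :=
  (fun y => dartEdge y.1) '' X.facialWalk x

/-- The family of (edge sets of) all face boundaries. -/
def faceBoundaries (X : EmbeddingScheme G) : Set (Set G.edgeSet) :=
  Set.range X.faceBoundary

/-- The embedding is strong: every face boundary is a cycle, that is,
no facial walk visits a vertex twice. -/
def IsStrong (X : EmbeddingScheme G) : Prop :=
  ∀ x, Set.InjOn (fun y : G.Dart × ℤˣ => y.1.fst) (X.facialWalk x)

/-- Two schemes describe the same embedding: one arises from the other by reversing the rotation at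
the vertices `v` with `ε v = -1`, changing the signature of an edge once for each such end. -/
def Equivalent (X Y : EmbeddingScheme G) : Prop :=
  ∃ ε : V → ℤˣ, (∀ d, Y.rot d = (X.rot ^ (ε d.fst : ℤ)) d) ∧
    ∀ d : G.Dart, Y.sgn (dartEdge d) = ε d.fst * X.sgn (dartEdge d) * ε d.snd

/-- The embedding is orientable: it is described by some scheme with trivial signature. -/
def Orientable (X : EmbeddingScheme G) : Prop :=
  ∃ Y : EmbeddingScheme G, X.Equivalent Y ∧ ∀ e, Y.sgn e = 1

end EmbeddingScheme

/-- `S` is a maximal free (linearly independent over `𝔽₂` in the cycle space) subfamily of `F`. -/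
def IsMaximalFree {E : Type*} (F S : Set (Set E)) : Prop :=
  Maximal (fun T : Set (Set E) =>
    T ⊆ F ∧ LinearIndepOn (ZMod 2) (fun γ : Set E => (γ.indicator 1 : E → ZMod 2)) T) S

/-! ### The local equations attached to a cycle -/

/-- A cyclic ordering `v_i, e_i` (`i` modulo the length) of a cycle with edge set `γ`: the edge `e_i`
joins `v_i` to `v_{i+1}`, and `dart i = (v_i, e_i)`. -/
structure CyclicOrdering {V : Type*} (G : SimpleGraph V) (γ : Set G.edgeSet) where
  len : ℕ
  three_le : 3 ≤ len
  dart : ZMod len → G.Dart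
  snd_eq : ∀ i, (dart i).snd = (dart (i + 1)).fst
  inj : Function.Injective fun i => (dart i).fst
  edges : Set.range (fun i => dartEdge (dart i)) = γ

instance {V : Type*} {G : SimpleGraph V} {γ : Set G.edgeSet} (c : CyclicOrdering G γ) :
    NeZero c.len :=
  ⟨by have := c.three_le; omega⟩

section SiteEntries

variable {V : Type*} {G : SimpleGraph V} (ord : SiteOrder G) (A : Matrix G.Dart G.Dart ℂ)
  (v : V) (σ : Equiv.Perm (Fin 4))

/-- The site entry at `v` in the places `j`, `k` of the enumeration reordered by `σ`. -/
def siteEntry (j k : Fin 4) : ℂ := A (ord v (σ j)) (ord v (σ k))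

/-- `S_v(σ) = A_{σ 1, σ 2}`. -/
def siteS : ℂ := siteEntry ord A v σ 0 1
/-- `S̄_v(σ) = A_{σ 3, σ 4}`. -/
def siteSbar : ℂ := siteEntry ord A v σ 2 3
/-- `T_v(σ) = A_{σ 1, σ 3}`. -/
def siteT : ℂ := siteEntry ord A v σ 0 2
/-- `T̄_v(σ) = A_{σ 4, σ 2}`. -/
def siteTbar : ℂ := siteEntry ord A v σ 3 1
/-- `U_v(σ) = A_{σ 1, σ 4}`. -/
def siteU : ℂ := siteEntry ord A v σ 0 3

end SiteEntries

/-- `A` solves the cycle equations attached to the cycle `γ`.  Here `σ i` is the even rearrangement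
of the darts at `v_i` under which the cycle enters by the first one and leaves by the fourth one. -/
def SolvesCycleEquations {V : Type*} {G : SimpleGraph V} (ord : SiteOrder G)
    (A : Matrix G.Dart G.Dart ℂ) (γ : Set G.edgeSet) : Prop :=
  ∃ (c : CyclicOrdering G γ) (σ : ZMod c.len → Equiv.Perm (Fin 4)),
    let v : ZMod c.len → V := fun i => (c.dart i).fst
    let B : ZMod c.len → ℂ := fun i => A (c.dart i) (c.dart i).symm
    let S : ZMod c.len → ℂ := fun i => siteS ord A (v i) (σ i)
    let S' : ZMod c.len → ℂ := fun i => siteSbar ord A (v i) (σ i)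
    let T : ZMod c.len → ℂ := fun i => siteT ord A (v i) (σ i)
    let T' : ZMod c.len → ℂ := fun i => siteTbar ord A (v i) (σ i)
    let U : ZMod c.len → ℂ := fun i => siteU ord A (v i) (σ i)
    (∀ i, Equiv.Perm.sign (σ i) = 1 ∧ (ord (v i) (σ i 0) : G.Dart) = (c.dart (i - 1)).symm ∧
      (ord (v i) (σ i 3) : G.Dart) = c.dart i) ∧
    -- the entries associated with the vertices and edges of the cycle do not vanish
    (∀ i, B i ≠ 0) ∧
    (∀ i, ∀ d d' : G.Dart, d.fst = v i → d'.fst = v i → d ≠ d' → A d d' ≠ 0) ∧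
    (∀ i, S i * S' i + T i * T' i = 0) ∧
    (∀ i, B i ^ 2 = -(U i * T' i / S i * (U (i + 1) * T (i + 1) / S' (i + 1)))) ∧
    ∏ i, B i = -∏ i, U i

/-! A matching contributes to the weight of `C` iff it contains exactly the edges of `C` and pairs
all other darts vertex by vertex. The weight is therefore a signed sum over the permutations all of
whose pairs are of these two kinds.

Invariance under a cycle γ is proved for normalized entries (`SiteCycle.Flat`): site entries square
to 1, and the triangle formed by the entering dart `p`, the leaving dart `d` and either lateral dart
has the same product `t = ±1`. It consists of a cancellation and a bijection. Where `C` avoids a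
vertex of γ, two of the three local pairings join γ to the lateral darts, and they cancel
(`sum_allowed_eq_sum_good`); this is `S S̄ + T T̄ = 0`. On the other permutations, left
multiplication by one permutation `ρ`, which rotates the darts along γ, exchanges `C` and `C ∆ γ`
(`exists_rotation`). Each entry changes by factors `φ` attached to its two darts, hence each term by
the constant `∏ φ`, and the product equation gives `sign ρ * ∏ φ = 1` (`exists_gauge`,
`exists_shift`).

For existence, number the darts at each vertex by `ZMod 4` along the rotation and let the site
entries be the signs of the order of these numbers. Triangle products are invariant under cyclic
shifts, so `t` is the turning sense of the face at the vertex. An edge entry is `±1` or `±i`, with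
square the signature, which is the change of turning sense along the edge. Only the product equation
may fail, and only by a sign for each face. As the family of faces is independent over 𝔽₂, signs of
the edges can be chosen to repair all faces at once (`exists_units_prod_eq`). If reversing rotations
trivializes the signature, the same construction is real.

Conversely, for a real solution the site equations say that the sign of the triangle product at a
corner (`cornerSign`) is the same at all corners of a vertex, and so orients the vertex. Positivity
of `B²` in the edge equations then makes the signature of an edge the product of the orientations at
its ends. One omitted face does no harm, since each edge and each vertex still meets a face of the
family (`mem_or_mem_of_isMaximalFree`). -/

/-! ### Permutations as matchings, and the weight as a sum over permutations -/

section Pairing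

variable {V : Type*} {G : SimpleGraph V}

theorem dartEdge_symm (d : G.Dart) : dartEdge d.symm = dartEdge d :=
  Subtype.ext d.edge_symm

theorem dartEdge_eq_iff {d e : G.Dart} : dartEdge d = dartEdge e ↔ d = e ∨ d = e.symm := by
  rw [← SimpleGraph.dart_edge_eq_iff]
  exact Subtype.ext_iff

theorem fst_symm_ne (d : G.Dart) : d.symm.fst ≠ d.fst := fun h => d.adj.ne h.symm

theorem ord_fst (ord : SiteOrder G) (v : V) (j : Fin 4) : (ord v j : G.Dart).fst = v :=
  (ord v j).2

theorem ord_inj (ord : SiteOrder G) {v w : V} {j k : Fin 4}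
    (h : (ord v j : G.Dart) = ord w k) : v = w ∧ j = k := by
  have hv : v = w := by rw [← ord_fst ord v j, h, ord_fst]
  subst hv
  exact ⟨rfl, (ord v).injective (Subtype.ext h)⟩

theorem exists_ord_eq (ord : SiteOrder G) (d : G.Dart) : ∃ v j, (ord v j : G.Dart) = d :=
  ⟨d.fst, (ord d.fst).symm ⟨d, rfl⟩, by simp⟩

/-- The place paired with a given one in the reference matching of a site. -/
def mate : Fin 4 → Fin 4 := ![1, 0, 3, 2]

theorem mate_ne (j : Fin 4) : mate j ≠ j := by revert j; decide

variable [Fintype V] [DecidableEq V]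

theorem mem_pairing_iff (ord : SiteOrder G) (σ : Equiv.Perm G.Dart) (a b : G.Dart) :
    s(a, b) ∈ pairing ord σ ↔ ∃ v j, a = σ (ord v j) ∧ b = σ (ord v (mate j)) := by
  simp only [pairing, Finset.mem_biUnion, Finset.mem_univ, true_and, Finset.mem_insert,
    Finset.mem_singleton, Sym2.eq_iff]
  refine exists_congr fun v => ⟨?_, ?_⟩
  · rintro ((h | h) | (h | h))
    exacts [⟨0, h⟩, ⟨1, h⟩, ⟨2, h⟩, ⟨3, h⟩]
  · rintro ⟨j, h⟩
    fin_cases j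
    exacts [Or.inl (Or.inl h), Or.inl (Or.inr h), Or.inr (Or.inl h), Or.inr (Or.inr h)]

theorem mem_pairing_mul (ord : SiteOrder G) (ρ σ : Equiv.Perm G.Dart) (a b : G.Dart) :
    s(ρ a, ρ b) ∈ pairing ord (ρ * σ) ↔ s(a, b) ∈ pairing ord σ := by
  simp [mem_pairing_iff]

theorem exists_mem_pairing (ord : SiteOrder G) (σ : Equiv.Perm G.Dart) (a : G.Dart) :
    ∃ b, s(a, b) ∈ pairing ord σ := by
  obtain ⟨v, j, h⟩ := exists_ord_eq ord (σ.symm a)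
  exact ⟨σ (ord v (mate j)), (mem_pairing_iff ..).2 ⟨v, j, by simp [h], rfl⟩⟩

theorem mem_pairing_unique {ord : SiteOrder G} {σ : Equiv.Perm G.Dart} {a b c : G.Dart}
    (hb : s(a, b) ∈ pairing ord σ) (hc : s(a, c) ∈ pairing ord σ) : b = c := by
  obtain ⟨v, j, rfl, rfl⟩ := (mem_pairing_iff ..).1 hb
  obtain ⟨w, k, h, rfl⟩ := (mem_pairing_iff ..).1 hc
  obtain ⟨rfl, rfl⟩ := ord_inj ord (σ.injective h)
  rfl

theorem ne_of_mem_pairing {ord : SiteOrder G} {σ : Equiv.Perm G.Dart} {a b : G.Dart}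
    (h : s(a, b) ∈ pairing ord σ) : a ≠ b := by
  obtain ⟨v, j, rfl, rfl⟩ := (mem_pairing_iff ..).1 h
  intro h
  exact mate_ne j (ord_inj ord (σ.injective h)).2.symm

/-- A pairing covers every dart exactly once whatever `σ` is, so only the adjacency of the paired
darts is at stake. -/
theorem isDartMatching_pairing_iff (ord : SiteOrder G) (σ : Equiv.Perm G.Dart) :
    IsDartMatching G (pairing ord σ) ↔
      ∀ a b, s(a, b) ∈ pairing ord σ → a.fst = b.fst ∨ b = a.symm := by
  constructor
  · intro h a b hab
    have := h.1 _ hab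
    rw [SimpleGraph.mem_edgeSet] at this
    obtain ⟨hne, h | h⟩ := this
    · exact Or.inl h
    · rcases SimpleGraph.dart_edge_eq_iff a b |>.1 h with h | h
      · exact absurd h hne
      · right; rw [h, SimpleGraph.Dart.symm_symm]
  · intro h
    refine ⟨fun p => ?_, fun d => ?_⟩
    · induction p using Sym2.ind with
      | _ a b =>
        intro hab
        refine ⟨ne_of_mem_pairing hab, (h a b hab).imp id ?_⟩
        rintro rfl
        exact a.edge_symm.symm
    · obtain ⟨b, hb⟩ := exists_mem_pairing ord σ d
      refine ⟨s(d, b), ⟨hb, Sym2.mem_mk_left _ _⟩, ?_⟩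
      rintro p ⟨hp, hd⟩
      obtain ⟨c, rfl⟩ := Sym2.mem_iff_exists.1 hd
      rw [mem_pairing_unique hb hp]

/-- The reference matching contains no edge of `G`, hence the symmetric difference with it does not
affect the edges. -/
theorem matchingCurve_eq_iff (ord : SiteOrder G) (σ : Equiv.Perm G.Dart) (C : Set G.edgeSet) :
    matchingCurve (refMatching ord) (pairing ord σ) = C ↔
      ∀ d : G.Dart, s(d, d.symm) ∈ pairing ord σ ↔ dartEdge d ∈ C := by
  have href : ∀ d : G.Dart, s(d, d.symm) ∉ refMatching ord := by
    intro d hd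
    obtain ⟨v, j, h1, h2⟩ := (mem_pairing_iff ..).1 hd
    refine fst_symm_ne d ?_
    rw [h2, h1]
    simp [ord_fst]
  have key : ∀ d : G.Dart, dartEdge d ∈ matchingCurve (refMatching ord) (pairing ord σ) ↔
      s(d, d.symm) ∈ pairing ord σ := by
    intro d
    simp only [matchingCurve, Set.mem_ofPred_eq, Finset.mem_symmDiff, href, false_and, false_or,
      not_false_eq_true, and_true]
    constructor
    · rintro ⟨e, he, h⟩
      rcases dartEdge_eq_iff.1 he with rfl | rfl
      · exact h
      · rwa [SimpleGraph.Dart.symm_symm, Sym2.eq_swap] at h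
    · exact fun h => ⟨d, rfl, h⟩
  constructor
  · rintro rfl d
    exact (key d).symm
  · intro h
    ext e
    obtain ⟨e, he⟩ := e
    induction e using Sym2.ind with
    | _ v w =>
      let d : G.Dart := ⟨(v, w), he⟩
      exact (key d).trans (h d)

theorem prod_ord [DecidableRel G.Adj] (ord : SiteOrder G) (φ : G.Dart → ℂ) :
    ∏ v, ∏ j, φ (ord v j) = ∏ x, φ x := by
  rw [← Equiv.prod_comp (Equiv.sigmaFiberEquiv fun d : G.Dart => d.fst) φ, Fintype.prod_sigma]
  refine Finset.prod_congr rfl fun v _ => ?_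
  rw [← Equiv.prod_comp (ord v)]
  rfl

/-- Every dart lies in exactly one pair, so factors attached to darts multiply up to `∏ φ`, whatever
`σ` is. This lets one relabelling `ρ` act on a whole sum. -/
theorem pairProduct_mul [DecidableRel G.Adj] (ord : SiteOrder G) (A : Matrix G.Dart G.Dart ℂ)
    (ρ σ : Equiv.Perm G.Dart) (φ : G.Dart → ℂ)
    (h : ∀ a b, s(a, b) ∈ pairing ord σ → A (ρ a) (ρ b) = φ a * φ b * A a b) :
    pairProduct ord A (ρ * σ) = (∏ x, φ x) * pairProduct ord A σ := by
  rw [← Equiv.prod_comp σ φ, ← prod_ord ord fun x => φ (σ x), pairProduct, pairProduct,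
    ← Finset.prod_mul_distrib]
  refine Finset.prod_congr rfl fun v _ => ?_
  have h01 := h (σ (ord v 0)) (σ (ord v 1)) ((mem_pairing_iff ..).2 ⟨v, 0, rfl, rfl⟩)
  have h23 := h (σ (ord v 2)) (σ (ord v 3)) ((mem_pairing_iff ..).2 ⟨v, 2, rfl, rfl⟩)
  simp only [Equiv.Perm.mul_apply, h01, h23, Fin.prod_univ_four]
  ring

open Classical in
-- The inner sums run over the fibres of `pairing ord`, so the double sum collapses.
theorem curveWeight_eq_sum [DecidableRel G.Adj] (ord : SiteOrder G)
    (A : Matrix G.Dart G.Dart ℂ) (M₀ : Finset (Sym2 G.Dart)) (C : Set G.edgeSet) :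
    curveWeight ord A M₀ C =
      1 / (2 ^ (2 * Fintype.card V) * ((2 * Fintype.card V).factorial : ℂ)) *
        ∑ σ : Equiv.Perm G.Dart with
          IsDartMatching G (pairing ord σ) ∧ matchingCurve M₀ (pairing ord σ) = C,
          ((Equiv.Perm.sign σ : ℤ) : ℂ) * pairProduct ord A σ := by
  rw [curveWeight, ← Finset.mul_sum]
  congr 1
  rw [← Finset.sum_fiberwise_of_maps_to (g := pairing ord)
    (t := Finset.univ.filter fun M => IsDartMatching G M ∧ matchingCurve M₀ M = C)
    (fun σ hσ => by simpa using hσ)]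
  refine Finset.sum_congr rfl fun M hM => Finset.sum_congr ?_ fun _ _ => rfl
  ext σ
  simp only [Finset.mem_filter, Finset.mem_univ, true_and] at hM ⊢
  constructor
  · rintro rfl
    exact ⟨hM, rfl⟩
  · exact fun h => h.2

end Pairing

/-! ### Auxiliary permutations and their signs -/

section PermutationTools

/-- `κ` is the product of the disjoint transpositions of `u i` and `w i`, for `i ∈ D`. -/
theorem exists_swapping_perm {ι α : Type*} [DecidableEq ι] [Fintype α] [DecidableEq α]
    {u w : ι → α} (hu : u.Injective) (hw : w.Injective) (huw : ∀ i j, u i ≠ w j) (D : Finset ι) :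
    ∃ κ : Equiv.Perm α, Equiv.Perm.sign κ = (-1) ^ D.card ∧
      (∀ i ∈ D, κ (u i) = w i ∧ κ (w i) = u i) ∧
      ∀ x, (∀ i ∈ D, x ≠ u i ∧ x ≠ w i) → κ x = x := by
  induction D using Finset.induction_on with
  | empty => exact ⟨1, by simp⟩
  | insert i D hi ih =>
    obtain ⟨κ, hs, hD, hx⟩ := ih
    have hne : ∀ j ∈ D, j ≠ i := fun j hj h => hi (h ▸ hj)
    refine ⟨Equiv.swap (u i) (w i) * κ, ?_, ?_, ?_⟩
    · rw [Equiv.Perm.sign_mul, hs, Equiv.Perm.sign_swap (huw i i), Finset.card_insert_of_notMem hi,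
        pow_succ']
    · intro j hj
      rcases Finset.mem_insert.1 hj with rfl | hj
      · rw [Equiv.Perm.mul_apply, Equiv.Perm.mul_apply,
          hx (u j) fun k hk => ⟨fun h => hne k hk (hu h).symm, huw j k⟩,
          hx (w j) fun k hk => ⟨fun h => huw k j h.symm, fun h => hne k hk (hw h).symm⟩]
        simp
      · rw [Equiv.Perm.mul_apply, Equiv.Perm.mul_apply, (hD j hj).1, (hD j hj).2,
          Equiv.swap_apply_of_ne_of_ne (fun h => huw i j h.symm) fun h => hne j hj (hw h),
          Equiv.swap_apply_of_ne_of_ne (fun h => hne j hj (hu h)) (huw j i)]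
        exact ⟨rfl, rfl⟩
    · intro x h
      rw [Equiv.Perm.mul_apply, hx x fun j hj => h j (Finset.mem_insert_of_mem hj),
        Equiv.swap_apply_of_ne_of_ne (h i (Finset.mem_insert_self _ _)).1
          (h i (Finset.mem_insert_self _ _)).2]

theorem sign_addRight_one (n : ℕ) [NeZero n] :
    -Equiv.Perm.sign (Equiv.addRight (1 : ZMod n)) = (-1) ^ n := by
  obtain ⟨m, rfl⟩ := Nat.exists_eq_succ_of_ne_zero (NeZero.ne n)
  have h2 : Equiv.Perm.sign (Equiv.addRight (1 : ZMod (m + 1))) = (-1) ^ m := by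
    have h : Equiv.Perm.sign (Equiv.addRight (1 : Fin (m + 1))) = (-1) ^ m := by
      rw [show Equiv.addRight (1 : Fin (m + 1)) = finRotate (m + 1) from
        Equiv.ext fun i => (finRotate_apply i).symm]
      exact sign_finRotate (m + 1)
    exact h
  rw [h2, pow_succ']
  simp

theorem exists_prod_extend {ι α : Type*} [Fintype ι] [DecidableEq ι] [Fintype α] [DecidableEq α]
    {u : ι → α} (hu : u.Injective) (c : ι → ℂ) :
    ∃ φ : α → ℂ, (∀ i, φ (u i) = c i) ∧ (∀ x, (∀ i, x ≠ u i) → φ x = 1) ∧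
      ∏ x, φ x = ∏ i, c i := by
  refine ⟨fun x => ∏ i, if x = u i then c i else 1, fun i => ?_, fun x hx => ?_, ?_⟩
  · simp [hu.eq_iff]
  · simp [hx]
  · rw [Finset.prod_comm]
    simp

end PermutationTools

/-! ### Rotating a matching along a cycle -/

/-- A closed walk `v_i` through pairwise distinct vertices of a four-valent graph: it enters `v_i` at the
dart `p i`, leaves it at the dart `d i`, and `q i`, `r i` are the other two darts at `v_i`. -/
structure SiteCycle {V : Type*} (G : SimpleGraph V) (n : ℕ) where
  p : ZMod n → G.Dart
  d : ZMod n → G.Dart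
  q : ZMod n → G.Dart
  r : ZMod n → G.Dart
  p_succ : ∀ i, p (i + 1) = (d i).symm
  fst_p : ∀ i, (p i).fst = (d i).fst
  fst_q : ∀ i, (q i).fst = (d i).fst
  fst_r : ∀ i, (r i).fst = (d i).fst
  inj : Function.Injective fun i => (d i).fst
  cover : ∀ i x, x.fst = (d i).fst → x = p i ∨ x = d i ∨ x = q i ∨ x = r i
  p_ne_d : ∀ i, p i ≠ d i
  p_ne_q : ∀ i, p i ≠ q i
  p_ne_r : ∀ i, p i ≠ r i
  d_ne_q : ∀ i, d i ≠ q i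
  d_ne_r : ∀ i, d i ≠ r i
  q_ne_r : ∀ i, q i ≠ r i

namespace SiteCycle

variable {V : Type*} {G : SimpleGraph V} {n : ℕ} (Z : SiteCycle G n)

/-- The edges of the closed walk. -/
def edges : Set G.edgeSet := Set.range fun i => dartEdge (Z.d i)

theorem d_mem (i : ZMod n) : dartEdge (Z.d i) ∈ Z.edges := ⟨i, rfl⟩

theorem p_eq (i : ZMod n) : Z.p i = (Z.d (i - 1)).symm := by
  rw [← Z.p_succ, sub_add_cancel]

theorem dartEdge_p (i : ZMod n) : dartEdge (Z.p i) = dartEdge (Z.d (i - 1)) := by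
  rw [Z.p_eq, dartEdge_symm]

theorem p_mem (i : ZMod n) : dartEdge (Z.p i) ∈ Z.edges := by
  rw [Z.dartEdge_p]
  exact Z.d_mem _

theorem mem_edges_iff (a : G.Dart) : dartEdge a ∈ Z.edges ↔ ∃ i, a = Z.d i ∨ a = Z.p i := by
  constructor
  · rintro ⟨i, hi⟩
    rcases dartEdge_eq_iff.1 hi.symm with h | h
    · exact ⟨i, Or.inl h⟩
    · exact ⟨i + 1, Or.inr (by rw [h, Z.p_succ])⟩
  · rintro ⟨i, rfl | rfl⟩
    exacts [Z.d_mem i, Z.p_mem i]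

theorem not_mem_edges {a : G.Dart} {i : ZMod n} (h : a.fst = (Z.d i).fst) (hp : a ≠ Z.p i)
    (hd : a ≠ Z.d i) : dartEdge a ∉ Z.edges := by
  rw [Z.mem_edges_iff]
  rintro ⟨j, hj⟩
  have hij : j = i := Z.inj (by rcases hj with rfl | rfl <;> simp_all [Z.fst_p])
  subst hij
  tauto

theorem q_notMem (i : ZMod n) : dartEdge (Z.q i) ∉ Z.edges :=
  Z.not_mem_edges (Z.fst_q i) (Z.p_ne_q i).symm (Z.d_ne_q i).symm

theorem r_notMem (i : ZMod n) : dartEdge (Z.r i) ∉ Z.edges :=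
  Z.not_mem_edges (Z.fst_r i) (Z.p_ne_r i).symm (Z.d_ne_r i).symm

theorem idx {i j : ZMod n} (h : (Z.d i).fst = (Z.d j).fst) : i = j := Z.inj h

theorem p_inj : Function.Injective Z.p := fun i j h => Z.idx <| by
  rw [← Z.fst_p, h, Z.fst_p]

theorem d_inj : Function.Injective Z.d := fun i j h => Z.idx (by rw [h])

theorem r_inj : Function.Injective Z.r := fun i j h => Z.idx <| by
  rw [← Z.fst_r, h, Z.fst_r]

theorem p_ne_d' (i j : ZMod n) : Z.p i ≠ Z.d j := fun h =>
  have : i = j := Z.idx (by rw [← Z.fst_p, h])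
  Z.p_ne_d j (this ▸ h)

theorem p_ne_r' (i j : ZMod n) : Z.p i ≠ Z.r j := fun h =>
  have : i = j := Z.idx (by rw [← Z.fst_p, h, Z.fst_r])
  Z.p_ne_r j (this ▸ h)

theorem d_ne_r' (i j : ZMod n) : Z.d i ≠ Z.r j := fun h =>
  have : i = j := Z.idx (by rw [h, Z.fst_r])
  Z.d_ne_r j (this ▸ h)

theorem q_ne_p' (i j : ZMod n) : Z.q i ≠ Z.p j := fun h =>
  have : i = j := Z.idx (by rw [← Z.fst_q, h, Z.fst_p])
  Z.p_ne_q j (this ▸ h.symm)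

theorem q_ne_d' (i j : ZMod n) : Z.q i ≠ Z.d j := fun h =>
  have : i = j := Z.idx (by rw [← Z.fst_q, h])
  Z.d_ne_q j (this ▸ h.symm)

theorem q_ne_r' (i j : ZMod n) : Z.q i ≠ Z.r j := fun h =>
  have : i = j := Z.idx (by rw [← Z.fst_q, h, Z.fst_r])
  Z.q_ne_r j (this ▸ h)

/-- The parity condition on `C` at the vertices of the walk, where moreover the two lateral darts are
named in such a way that `q i` is in `C` if one of them is. -/
structure Adapted (C : Set G.edgeSet) : Prop where
  parity : ∀ i, (dartEdge (Z.p i) ∈ C ↔ dartEdge (Z.d i) ∈ C) ↔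
    (dartEdge (Z.q i) ∈ C ↔ dartEdge (Z.r i) ∈ C)
  q_mem : ∀ i, dartEdge (Z.r i) ∈ C → dartEdge (Z.q i) ∈ C

variable {Z}

theorem Adapted.symmDiff {C : Set G.edgeSet} (h : Z.Adapted C) :
    Z.Adapted (symmDiff C Z.edges) := by
  refine ⟨fun i => ?_, fun i => ?_⟩
  · have := h.parity i
    simp only [Set.mem_symmDiff, Z.p_mem, Z.d_mem, Z.q_notMem, Z.r_notMem]
    tauto
  · have := h.q_mem i
    simp only [Set.mem_symmDiff, Z.q_notMem, Z.r_notMem]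
    tauto

theorem Adapted.not_detour {C : Set G.edgeSet} (h : Z.Adapted C) {i : ZMod n}
    (hp : dartEdge (Z.p i) ∉ C) (hd : dartEdge (Z.d i) ∉ C) :
    ¬(dartEdge (Z.q i) ∈ C ∧ dartEdge (Z.r i) ∉ C) := by
  have := h.parity i
  tauto

theorem Adapted.d_mem {C : Set G.edgeSet} (h : Z.Adapted C) {i : ZMod n}
    (hp : dartEdge (Z.p i) ∉ C) (hq : dartEdge (Z.q i) ∈ C) (hr : dartEdge (Z.r i) ∉ C) :
    dartEdge (Z.d i) ∈ C := by
  have := h.parity i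
  tauto

theorem Adapted.d_mem' {C : Set G.edgeSet} (h : Z.Adapted C) {i : ZMod n}
    (hp : dartEdge (Z.p i) ∈ C) (hD : ¬(dartEdge (Z.q i) ∈ C ∧ dartEdge (Z.r i) ∉ C)) :
    dartEdge (Z.d i) ∈ C := by
  have := h.parity i
  have := h.q_mem i
  tauto

variable (Z)

/-- Normalized weights: the cycle equations for entries which are fourth roots of unity. -/
structure Flat [NeZero n] (A : Matrix G.Dart G.Dart ℂ) (t : ZMod n → ℂ) : Prop where
  antisymm : ∀ a b, A b a = -A a b
  sq : ∀ a b, a.fst = b.fst → a ≠ b → A a b * A a b = 1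
  t_sq : ∀ i, t i * t i = 1
  tri_q : ∀ i, A (Z.p i) (Z.d i) * A (Z.d i) (Z.q i) * A (Z.p i) (Z.q i) = t i
  tri_r : ∀ i, A (Z.p i) (Z.d i) * A (Z.d i) (Z.r i) * A (Z.p i) (Z.r i) = t i
  edge_sq : ∀ i, A (Z.d i) (Z.d i).symm * A (Z.d i) (Z.d i).symm = t i * t (i + 1)
  prod : ∏ i, A (Z.d i) (Z.d i).symm = -∏ i, A (Z.p i) (Z.d i)

/-- The pairs which occur in the matchings that contribute to the weight of `C` after cancellation
at the vertices of the walk. -/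
def IsGoodPair (C : Set G.edgeSet) (a b : G.Dart) : Prop :=
  (b = a.symm ∧ dartEdge a ∈ C) ∨
    (a.fst = b.fst ∧ a ≠ b ∧ dartEdge a ∉ C ∧ dartEdge b ∉ C ∧
      ∀ i, a.fst = (Z.d i).fst → dartEdge (Z.q i) ∉ C →
        ((a = Z.p i ∨ a = Z.d i) ↔ (b = Z.p i ∨ b = Z.d i)))

variable {Z}

theorem IsGoodPair.symm {C : Set G.edgeSet} {a b : G.Dart} (h : Z.IsGoodPair C a b) :
    Z.IsGoodPair C b a := by
  rcases h with ⟨rfl, h⟩ | ⟨h1, h2, h3, h4, h5⟩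
  · exact Or.inl ⟨(SimpleGraph.Dart.symm_symm a).symm, by rwa [dartEdge_symm]⟩
  · exact Or.inr ⟨h1.symm, h2.symm, h4, h3, fun i hi hq => (h5 i (h1.trans hi) hq).symm⟩

theorem isGoodPair_site {C : Set G.edgeSet} {a b : G.Dart} (i : ZMod n)
    (ha : a.fst = (Z.d i).fst) (hb : b.fst = (Z.d i).fst) (hab : a ≠ b)
    (haC : dartEdge a ∉ C) (hbC : dartEdge b ∉ C)
    (h : dartEdge (Z.q i) ∉ C → ((a = Z.p i ∨ a = Z.d i) ↔ (b = Z.p i ∨ b = Z.d i))) :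
    Z.IsGoodPair C a b := by
  refine Or.inr ⟨ha.trans hb.symm, hab, haC, hbC, fun j hj => ?_⟩
  obtain rfl : i = j := Z.idx (ha.symm.trans hj)
  exact h

variable [Fintype V] [DecidableEq V] [DecidableRel G.Adj] [NeZero n]

open Classical in
-- `ρ` is the cycle `d i → p (i+1) → d (i+1) → ⋯`, with the detour `p i → r i → d i` at each `i ∈
-- D`. Its length is `2n + |D|`, whence its sign.
theorem exists_rotation (Z : SiteCycle G n) (D : Finset (ZMod n)) :
    ∃ ρ : Equiv.Perm G.Dart, Equiv.Perm.sign ρ = -(-1) ^ D.card ∧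
      (∀ i, ρ (Z.d i) = Z.p (i + 1)) ∧ (∀ i, i ∉ D → ρ (Z.p i) = Z.d i) ∧
      (∀ i, i ∈ D → ρ (Z.p i) = Z.r i) ∧ (∀ i, i ∈ D → ρ (Z.r i) = Z.d i) ∧
      ∀ x, (∀ i, x ≠ Z.p i ∧ x ≠ Z.d i ∧ (i ∈ D → x ≠ Z.r i)) → ρ x = x := by
  obtain ⟨κ, κs, κ1, κ2⟩ := exists_swapping_perm Z.p_inj Z.d_inj Z.p_ne_d' Finset.univ
  obtain ⟨μ, μs, μ1, μ2⟩ := exists_swapping_perm Z.p_inj Z.r_inj Z.p_ne_r' D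
  let ν : Equiv.Perm G.Dart := (Equiv.addRight (1 : ZMod n)).viaFintypeEmbedding ⟨Z.d, Z.d_inj⟩
  have ν1 : ∀ i, ν (Z.d i) = Z.d (i + 1) := fun i =>
    (Equiv.addRight (1 : ZMod n)).viaFintypeEmbedding_apply_image ⟨Z.d, Z.d_inj⟩ i
  have ν2 : ∀ x, (∀ i, x ≠ Z.d i) → ν x = x := fun x hx =>
    (Equiv.addRight (1 : ZMod n)).viaFintypeEmbedding_apply_notMem_range ⟨Z.d, Z.d_inj⟩
      (by rintro ⟨i, hi⟩; exact hx i hi.symm)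
  have νs : -Equiv.Perm.sign ν = (-1) ^ n := by
    rw [← sign_addRight_one n]
    congr 1
    exact (Equiv.addRight (1 : ZMod n)).viaFintypeEmbedding_sign ⟨Z.d, Z.d_inj⟩
  -- `μ` inserts the detours, `ν` shifts the leaving darts, and `κ` exchanges entering and leaving
  -- darts.
  let ρ : Equiv.Perm G.Dart := κ * ν * μ
  have hρ : ∀ x, ρ x = κ (ν (μ x)) := fun x => rfl
  have ρd : ∀ i, ρ (Z.d i) = Z.p (i + 1) := fun i => by
    rw [hρ, μ2 _ fun j _ => ⟨(Z.p_ne_d' j i).symm, Z.d_ne_r' i j⟩, ν1, (κ1 _ (Finset.mem_univ _)).2]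
  have ρp : ∀ i, i ∉ D → ρ (Z.p i) = Z.d i := fun i hi => by
    rw [hρ, μ2 _ fun j hj => ⟨fun h => hi (by rwa [Z.p_inj h]), Z.p_ne_r' i j⟩, ν2 _ (Z.p_ne_d' i),
      (κ1 _ (Finset.mem_univ _)).1]
  have ρp' : ∀ i, i ∈ D → ρ (Z.p i) = Z.r i := fun i hi => by
    rw [hρ, (μ1 i hi).1, ν2 _ fun j => (Z.d_ne_r' j i).symm,
      κ2 _ fun j _ => ⟨(Z.p_ne_r' j i).symm, (Z.d_ne_r' j i).symm⟩]
  have ρr : ∀ i, i ∈ D → ρ (Z.r i) = Z.d i := fun i hi => by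
    rw [hρ, (μ1 i hi).2, ν2 _ (Z.p_ne_d' i), (κ1 _ (Finset.mem_univ _)).1]
  have ρx : ∀ x, (∀ i, x ≠ Z.p i ∧ x ≠ Z.d i ∧ (i ∈ D → x ≠ Z.r i)) → ρ x = x := fun x hx => by
    rw [hρ, μ2 x fun i hi => ⟨(hx i).1, (hx i).2.2 hi⟩, ν2 x fun i => (hx i).2.1,
      κ2 x fun i _ => ⟨(hx i).1, (hx i).2.1⟩]
  have ρs : Equiv.Perm.sign ρ = -(-1) ^ D.card := by
    have : Equiv.Perm.sign ν = -(-1) ^ n := by rw [← νs, neg_neg]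
    rw [Equiv.Perm.sign_mul, Equiv.Perm.sign_mul, κs, μs, this, Finset.card_univ, ZMod.card,
      mul_neg, ← mul_pow]
    simp
  exact ⟨ρ, ρs, ρd, ρp, ρp', ρr, ρx⟩

/-- Exactly one of `c₁`, `c₂` holds precisely when `c₃ ∧ ¬c₄` does, so `a` occurs an even number of
times. -/
theorem prod_ite_parity {a : ℂ} (ha : a * a = 1) {c₁ c₂ c₃ c₄ : Prop} [Decidable c₁]
    [Decidable c₂] [Decidable (c₃ ∧ ¬c₄)] (h : (c₁ ↔ c₂) ↔ (c₃ ↔ c₄)) (h' : c₄ → c₃) :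
    (if c₂ then a else 1) * (if c₁ then a else 1) * (if c₃ ∧ ¬c₄ then a else 1) = 1 := by
  by_cases h1 : c₁ <;> by_cases h2 : c₂ <;> by_cases h3 : c₃ <;> by_cases h4 : c₄ <;>
    simp [h1, h2, h3, h4, ha] at h h' ⊢

open Classical in
-- The values of `φ` are dictated by the pairs that `ρ` has to move. In their product the edge
-- entries give `-∏ U` by the product equation, and the factors at `p` and `r` give a second `∏ U`.
-- The signs of the detours cancel, and the remaining factors `t` do so by parity.
theorem exists_gauge {A : Matrix G.Dart G.Dart ℂ} {t : ZMod n → ℂ} (hA : Z.Flat A t)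
    {C : Set G.edgeSet} (hC : Z.Adapted C) (D : Finset (ZMod n))
    (memD : ∀ i, i ∈ D ↔ dartEdge (Z.q i) ∈ C ∧ dartEdge (Z.r i) ∉ C) :
    ∃ φ : G.Dart → ℂ, (∏ x, φ x) * -(-1) ^ D.card = 1 ∧
      (∀ i, φ (Z.d i) = A (Z.d i) (Z.d i).symm *
        if dartEdge (Z.d i) ∈ C then t i * t (i + 1) else 1) ∧
      (∀ i, φ (Z.p i) = if i ∈ D then A (Z.p i) (Z.r i) else A (Z.p i) (Z.d i)) ∧
      (∀ i, φ (Z.r i) = if i ∈ D then -A (Z.d i) (Z.r i) else 1) ∧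
      ∀ x, (∀ i, x ≠ Z.p i ∧ x ≠ Z.d i ∧ (i ∈ D → x ≠ Z.r i)) → φ x = 1 := by
  let B : ZMod n → ℂ := fun i => A (Z.d i) (Z.d i).symm
  let U : ZMod n → ℂ := fun i => A (Z.p i) (Z.d i)
  have Usq : ∀ i, U i * U i = 1 := fun i => hA.sq _ _ (Z.fst_p i) (Z.p_ne_d i)
  -- Since `B i ^ 2 = t i * t (i + 1)` is a sign, `B i * β i` is `B i` for an edge to be added to
  -- `C` and the inverse of `B i` for an edge to be removed.
  let β : ZMod n → ℂ := fun i => if dartEdge (Z.d i) ∈ C then t i * t (i + 1) else 1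
  obtain ⟨φd, φd1, φd2, φd3⟩ := exists_prod_extend Z.d_inj fun i => B i * β i
  obtain ⟨φp, φp1, φp2, φp3⟩ := exists_prod_extend Z.p_inj
    fun i => if i ∈ D then A (Z.p i) (Z.r i) else U i
  obtain ⟨φr, φr1, φr2, φr3⟩ := exists_prod_extend Z.r_inj
    fun i => if i ∈ D then -A (Z.d i) (Z.r i) else 1
  let φ : G.Dart → ℂ := fun x => φd x * φp x * φr x
  have vd : ∀ i, φ (Z.d i) = B i * β i := fun i => by
    simp only [φ]
    rw [φd1, φp2 _ fun j => (Z.p_ne_d' j i).symm, φr2 _ fun j => Z.d_ne_r' i j, mul_one, mul_one]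
  have vp : ∀ i, φ (Z.p i) = if i ∈ D then A (Z.p i) (Z.r i) else U i := fun i => by
    simp only [φ]
    rw [φp1, φd2 _ fun j => Z.p_ne_d' i j, φr2 _ fun j => Z.p_ne_r' i j, one_mul, mul_one]
  have vr : ∀ i, φ (Z.r i) = if i ∈ D then -A (Z.d i) (Z.r i) else 1 := fun i => by
    simp only [φ]
    rw [φr1, φd2 _ fun j => (Z.d_ne_r' j i).symm, φp2 _ fun j => (Z.p_ne_r' j i).symm, one_mul,
      one_mul]
  have vx : ∀ x, (∀ i, x ≠ Z.p i ∧ x ≠ Z.d i ∧ (i ∈ D → x ≠ Z.r i)) → φ x = 1 := fun x hx => by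
    have : φr x = 1 := by
      by_cases h : ∃ i, x = Z.r i
      · obtain ⟨i, rfl⟩ := h
        rw [φr1, if_neg fun hi => (hx i).2.2 hi rfl]
      · push Not at h
        exact φr2 x h
    simp only [φ]
    rw [this, φd2 x fun i => (hx i).2.1, φp2 x fun i => (hx i).1, one_mul, one_mul]
  have hshift : ∀ i, dartEdge (Z.p (i + 1)) = dartEdge (Z.d i) := fun i => by
    rw [Z.p_succ, dartEdge_symm]
  refine ⟨φ, ?_, vd, vp, vr, vx⟩
  · have hU : (∏ i, U i) * ∏ i, U i = 1 := by
      rw [← Finset.prod_mul_distrib]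
      exact Finset.prod_eq_one fun i _ => Usq i
    have hD : ((-1 : ℂ)) ^ D.card = ∏ i, if i ∈ D then (-1 : ℂ) else 1 := by
      rw [Finset.prod_ite_mem, Finset.univ_inter, Finset.prod_const]
    have hpr : (-1 : ℂ) ^ D.card * ((∏ i, if i ∈ D then A (Z.p i) (Z.r i) else U i) *
        ∏ i, if i ∈ D then -A (Z.d i) (Z.r i) else 1) =
        (∏ i, U i) * ∏ i, if i ∈ D then t i else 1 := by
      rw [hD, ← Finset.prod_mul_distrib, ← Finset.prod_mul_distrib, ← Finset.prod_mul_distrib]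
      refine Finset.prod_congr rfl fun i _ => ?_
      split_ifs
      · rw [← hA.tri_r i]
        linear_combination (-A (Z.d i) (Z.r i) * A (Z.p i) (Z.r i)) * Usq i
      · ring
    have hβ : (∏ i, β i) * (∏ i, if i ∈ D then t i else 1) = 1 := by
      let g : ZMod n → ℂ := fun i => if dartEdge (Z.p i) ∈ C then t i else 1
      -- The two factors of `t i * t (i + 1)` are sent to the two ends of the edge, so that parity
      -- can be used vertex by vertex.
      have h1 : ∏ i, β i = (∏ i, if dartEdge (Z.d i) ∈ C then t i else 1) * ∏ i, g i := by
        rw [← Equiv.prod_comp (Equiv.addRight (1 : ZMod n)) g, ← Finset.prod_mul_distrib]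
        refine Finset.prod_congr rfl fun i _ => ?_
        simp only [β, g, Equiv.coe_addRight, hshift]
        split_ifs <;> simp
      rw [h1, ← Finset.prod_mul_distrib, ← Finset.prod_mul_distrib]
      refine Finset.prod_eq_one fun i _ => ?_
      simp only [g, memD]
      exact prod_ite_parity (hA.t_sq i) (hC.parity i) (hC.q_mem i)
    simp only [φ]
    rw [Finset.prod_mul_distrib, Finset.prod_mul_distrib, φd3, φp3, φr3,
      Finset.prod_mul_distrib]
    have hB : ∏ i, B i = -∏ i, U i := hA.prod
    rw [hB]
    linear_combination (∏ i, U i) * (∏ i, β i) * hpr + (∏ i, U i) * (∏ i, U i) * hβ + hU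

open Classical in
-- At a vertex of `D` exactly one lateral dart, hence exactly one of `p` and `d`, is in `C`, and `r`
-- is paired with the other one. `ρ` turns an edge of the walk in `C` into a site pair at its end,
-- turns the pairs `{p, d}` and `{r, d}` into the next edge, and turns `{r, p}` into `{d, r}`.
theorem exists_shift {A : Matrix G.Dart G.Dart ℂ} {t : ZMod n → ℂ} (hA : Z.Flat A t)
    {C : Set G.edgeSet} (hC : Z.Adapted C) :
    ∃ (ρ : Equiv.Perm G.Dart) (φ : G.Dart → ℂ),
      (((Equiv.Perm.sign ρ : ℤ) : ℂ) * ∏ x, φ x = 1) ∧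
      ∀ a b, Z.IsGoodPair C a b → Z.IsGoodPair (symmDiff C Z.edges) (ρ a) (ρ b) ∧
        A (ρ a) (ρ b) = φ a * φ b * A a b := by
  let D : Finset (ZMod n) :=
    Finset.univ.filter fun i => dartEdge (Z.q i) ∈ C ∧ dartEdge (Z.r i) ∉ C
  have memD : ∀ i, i ∈ D ↔ dartEdge (Z.q i) ∈ C ∧ dartEdge (Z.r i) ∉ C := by simp [D]
  obtain ⟨ρ, ρs, ρd, ρp, ρp', ρr, ρx⟩ := exists_rotation Z D
  obtain ⟨φ, φs, vd, vp, vr, vx⟩ := exists_gauge hA hC D memD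
  clear_value D
  let B : ZMod n → ℂ := fun i => A (Z.d i) (Z.d i).symm
  let U : ZMod n → ℂ := fun i => A (Z.p i) (Z.d i)
  have Usq : ∀ i, U i * U i = 1 := fun i => hA.sq _ _ (Z.fst_p i) (Z.p_ne_d i)
  have prsq : ∀ i, A (Z.p i) (Z.r i) * A (Z.p i) (Z.r i) = 1 := fun i =>
    hA.sq _ _ ((Z.fst_p i).trans (Z.fst_r i).symm) (Z.p_ne_r i)
  have drsq : ∀ i, A (Z.d i) (Z.r i) * A (Z.d i) (Z.r i) = 1 := fun i =>
    hA.sq _ _ (Z.fst_r i).symm (Z.d_ne_r i)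
  have Bsq : ∀ i, B i * B i = t i * t (i + 1) := hA.edge_sq
  have hshift : ∀ i, dartEdge (Z.p (i + 1)) = dartEdge (Z.d i) := fun i => by
    rw [Z.p_succ, dartEdge_symm]
  refine ⟨ρ, φ, ?_, ?_⟩
  · rw [ρs, ← φs]
    push_cast
    ring
  · intro a b hab
    have hfix : ∀ x, (∀ i, x ≠ Z.p i ∧ x ≠ Z.d i) → (∀ i, i ∈ D → x ≠ Z.r i) →
        ρ x = x ∧ φ x = 1 := fun x h1 h2 =>
      ⟨ρx x fun i => ⟨(h1 i).1, (h1 i).2, h2 i⟩, vx x fun i => ⟨(h1 i).1, (h1 i).2, h2 i⟩⟩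
    have hsymm : ∀ a b, (Z.IsGoodPair (symmDiff C Z.edges) (ρ a) (ρ b) ∧
        A (ρ a) (ρ b) = φ a * φ b * A a b) → (Z.IsGoodPair (symmDiff C Z.edges) (ρ b) (ρ a) ∧
        A (ρ b) (ρ a) = φ b * φ a * A b a) := fun a b h =>
      ⟨h.1.symm, by rw [hA.antisymm (ρ a), hA.antisymm a, h.2]; ring⟩
    -- the edges of the walk which belong to `C`
    have hedge : ∀ i, dartEdge (Z.d i) ∈ C →
        Z.IsGoodPair (symmDiff C Z.edges) (ρ (Z.d i)) (ρ (Z.p (i + 1))) ∧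
        A (ρ (Z.d i)) (ρ (Z.p (i + 1))) = φ (Z.d i) * φ (Z.p (i + 1)) * A (Z.d i) (Z.p (i + 1)) := by
      intro i hi
      have hp : dartEdge (Z.p (i + 1)) ∈ C := by rwa [hshift]
      -- The factor at `d i` cancels the entry of the edge; what remains is the factor at `p (i +
      -- 1)`, chosen to be the new site entry.
      have hcoef : φ (Z.d i) * A (Z.d i) (Z.p (i + 1)) = 1 := by
        rw [vd, Z.p_succ]
        rw [if_pos hi]
        change B i * (t i * t (i + 1)) * B i = 1
        linear_combination (t i * t (i + 1)) * Bsq i + (t (i + 1) * t (i + 1)) * hA.t_sq i +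
          hA.t_sq (i + 1)
      have hp' : dartEdge (Z.p (i + 1)) ∉ symmDiff C Z.edges := by
        simp [Set.mem_symmDiff, hp, Z.p_mem]
      by_cases hD : i + 1 ∈ D
      · have hr : dartEdge (Z.r (i + 1)) ∉ symmDiff C Z.edges := by
          simp [Set.mem_symmDiff, ((memD _).1 hD).2, Z.r_notMem]
        rw [ρd, ρp' _ hD, mul_right_comm, hcoef, vp, if_pos hD, one_mul]
        refine ⟨isGoodPair_site (i + 1) (Z.fst_p _) (Z.fst_r _) (Z.p_ne_r _) hp' hr fun hq => ?_,
          rfl⟩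
        exact absurd ((memD _).1 hD).1 fun h => hq (Or.inl ⟨h, Z.q_notMem _⟩)
      · have hd : dartEdge (Z.d (i + 1)) ∉ symmDiff C Z.edges := by
          rw [memD] at hD
          simp [Set.mem_symmDiff, Z.d_mem, hC.d_mem' hp hD]
        rw [ρd, ρp _ hD, mul_right_comm, hcoef, vp, if_neg hD, one_mul]
        exact ⟨isGoodPair_site (i + 1) (Z.fst_p _) rfl (Z.p_ne_d _) hp' hd fun _ => by simp, rfl⟩
    rcases hab with ⟨rfl, ha⟩ | ⟨h1, h2, h3, h4, h5⟩
    · by_cases hγ : dartEdge a ∈ Z.edges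
      · obtain ⟨i, rfl | rfl⟩ := (Z.mem_edges_iff a).1 hγ
        · rw [← Z.p_succ]
          exact hedge i ha
        · have h := hedge (i - 1) (by rwa [← Z.dartEdge_p])
          rw [sub_add_cancel] at h
          rw [Z.p_eq, SimpleGraph.Dart.symm_symm, ← Z.p_eq]
          exact hsymm _ _ h
      · have hoff : ∀ x : G.Dart, dartEdge x ∉ Z.edges → dartEdge x ∈ C → ρ x = x ∧ φ x = 1 := by
          intro x hx hxC
          refine hfix x (fun i => ⟨?_, ?_⟩) fun i hi => ?_
          · rintro rfl; exact hx (Z.p_mem i)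
          · rintro rfl; exact hx (Z.d_mem i)
          · rintro rfl; exact ((memD i).1 hi).2 hxC
        obtain ⟨e1, e2⟩ := hoff a hγ ha
        obtain ⟨e3, e4⟩ := hoff a.symm (by rwa [dartEdge_symm]) (by rwa [dartEdge_symm])
        rw [e1, e2, e3, e4, one_mul, one_mul]
        exact ⟨Or.inl ⟨rfl, Or.inl ⟨ha, hγ⟩⟩, rfl⟩
    · by_cases hv : ∃ i, a.fst = (Z.d i).fst
      · obtain ⟨i, hi⟩ := hv
        have hi' : b.fst = (Z.d i).fst := h1.symm.trans hi
        replace h5 := h5 i hi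
        -- the two possibilities for a pair which contains `d i`
        have hpd : dartEdge (Z.d i) ∉ C → i ∉ D →
            Z.IsGoodPair (symmDiff C Z.edges) (ρ (Z.p i)) (ρ (Z.d i)) ∧
            A (ρ (Z.p i)) (ρ (Z.d i)) = φ (Z.p i) * φ (Z.d i) * A (Z.p i) (Z.d i) := by
          intro hd hD
          rw [ρp i hD, ρd, vp, vd, if_neg hD, Z.p_succ]
          rw [if_neg hd]
          refine ⟨Or.inl ⟨rfl, Or.inr ⟨Z.d_mem i, hd⟩⟩, ?_⟩
          change B i = U i * (B i * 1) * U i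
          linear_combination -B i * Usq i
        have hrd : dartEdge (Z.d i) ∉ C → i ∈ D →
            Z.IsGoodPair (symmDiff C Z.edges) (ρ (Z.r i)) (ρ (Z.d i)) ∧
            A (ρ (Z.r i)) (ρ (Z.d i)) = φ (Z.r i) * φ (Z.d i) * A (Z.r i) (Z.d i) := by
          intro hd hD
          rw [ρr i hD, ρd, vr, vd, if_pos hD, Z.p_succ, hA.antisymm (Z.d i) (Z.r i)]
          rw [if_neg hd]
          refine ⟨Or.inl ⟨rfl, Or.inr ⟨Z.d_mem i, hd⟩⟩, ?_⟩
          change B i = -A (Z.d i) (Z.r i) * (B i * 1) * -A (Z.d i) (Z.r i)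
          linear_combination -B i * drsq i
        have hrp : dartEdge (Z.d i) ∈ C → i ∈ D →
            Z.IsGoodPair (symmDiff C Z.edges) (ρ (Z.r i)) (ρ (Z.p i)) ∧
            A (ρ (Z.r i)) (ρ (Z.p i)) = φ (Z.r i) * φ (Z.p i) * A (Z.r i) (Z.p i) := by
          intro hd hD
          rw [ρr i hD, ρp' i hD, vr, vp, if_pos hD, if_pos hD, hA.antisymm (Z.p i) (Z.r i)]
          have hr : dartEdge (Z.r i) ∉ symmDiff C Z.edges := by
            simp [Set.mem_symmDiff, ((memD _).1 hD).2, Z.r_notMem]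
          have hd' : dartEdge (Z.d i) ∉ symmDiff C Z.edges := by
            simp [Set.mem_symmDiff, hd, Z.d_mem]
          refine ⟨isGoodPair_site i rfl (Z.fst_r _) (Z.d_ne_r _) hd' hr fun hq => ?_, ?_⟩
          · exact absurd ((memD _).1 hD).1 fun h => hq (Or.inl ⟨h, Z.q_notMem _⟩)
          · linear_combination -A (Z.d i) (Z.r i) * prsq i
        have hqr' : i ∉ D → dartEdge (Z.q i) ∉ C →
            Z.IsGoodPair (symmDiff C Z.edges) (ρ (Z.q i)) (ρ (Z.r i)) ∧
            A (ρ (Z.q i)) (ρ (Z.r i)) = φ (Z.q i) * φ (Z.r i) * A (Z.q i) (Z.r i) := by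
          intro hD hq
          obtain ⟨e1, e2⟩ := hfix (Z.q i) (fun j => ⟨Z.q_ne_p' i j, Z.q_ne_d' i j⟩)
            fun j _ => Z.q_ne_r' i j
          obtain ⟨e3, e4⟩ := hfix (Z.r i)
            (fun j => ⟨(Z.p_ne_r' j i).symm, (Z.d_ne_r' j i).symm⟩)
            fun j hj h => hD (by rwa [Z.r_inj h])
          rw [e1, e2, e3, e4, one_mul, one_mul]
          refine ⟨isGoodPair_site i (Z.fst_q i) (Z.fst_r i) (Z.q_ne_r i) ?_ ?_ fun _ => ?_, rfl⟩
          · simp [Set.mem_symmDiff, hq, Z.q_notMem]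
          · simp [Set.mem_symmDiff, mt (hC.q_mem i) hq, Z.r_notMem]
          · simp [Z.q_ne_p', Z.q_ne_d', (Z.p_ne_r _).symm, (Z.d_ne_r _).symm]
        have hcross : ∀ x y, (x = Z.p i ∨ x = Z.d i) →
            (y = Z.q i ∨ y = Z.r i) → ¬((x = Z.p i ∨ x = Z.d i) ↔ (y = Z.p i ∨ y = Z.d i)) := by
          rintro x y hx (rfl | rfl) h
          · exact (h.1 hx).elim (Z.q_ne_p' i i) (Z.q_ne_d' i i)
          · exact (h.1 hx).elim (Z.p_ne_r i).symm (Z.d_ne_r i).symm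
        -- If `q i` is not in `C`, goodness forbids joining `p i` or `d i` to a lateral dart. Such a
        -- mixed pair therefore contains `r i`, with `q i` in `C`, which means that `i ∈ D`.
        rw [memD] at hpd hrd hrp hqr'
        rcases Z.cover i a hi with rfl | rfl | rfl | rfl <;>
          rcases Z.cover i b hi' with rfl | rfl | rfl | rfl
        · exact absurd rfl h2
        · exact hpd h4 (hC.not_detour h3 h4)
        · exact absurd (h5 h4) (hcross _ _ (Or.inl rfl) (Or.inl rfl))
        · exact hsymm _ _ (hrp (hC.d_mem h3 (not_not.1 fun hq => hcross _ _ (Or.inl rfl) (Or.inr rfl) (h5 hq)) h4) ⟨not_not.1 fun hq => hcross _ _ (Or.inl rfl) (Or.inr rfl) (h5 hq), h4⟩)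
        · exact hsymm _ _ (hpd h3 (hC.not_detour h4 h3))
        · exact absurd rfl h2
        · exact absurd (h5 h4) (hcross _ _ (Or.inr rfl) (Or.inl rfl))
        · exact hsymm _ _ (hrd h3 ⟨not_not.1 fun hq => hcross _ _ (Or.inr rfl) (Or.inr rfl) (h5 hq), h4⟩)
        · exact absurd (h5 h3).symm (hcross _ _ (Or.inl rfl) (Or.inl rfl))
        · exact absurd (h5 h3).symm (hcross _ _ (Or.inr rfl) (Or.inl rfl))
        · exact absurd rfl h2
        · exact hqr' (fun h => h3 h.1) h3
        · exact hrp (hC.d_mem h4 (not_not.1 fun hq => hcross _ _ (Or.inl rfl) (Or.inr rfl) (h5 hq).symm) h3) ⟨not_not.1 fun hq => hcross _ _ (Or.inl rfl) (Or.inr rfl) (h5 hq).symm, h3⟩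
        · exact hrd h4 ⟨not_not.1 fun hq => hcross _ _ (Or.inr rfl) (Or.inr rfl) (h5 hq).symm, h3⟩
        · exact hsymm _ _ (hqr' (fun h => h4 h.1) h4)
        · exact absurd rfl h2
      · push Not at hv
        have hoff : ∀ x : G.Dart, (∀ i, x.fst ≠ (Z.d i).fst) → ρ x = x ∧ φ x = 1 := by
          intro x hx
          refine hfix x (fun i => ⟨?_, ?_⟩) fun i _ => ?_
          · rintro rfl; exact hx i (Z.fst_p i)
          · rintro rfl; exact hx i rfl
          · rintro rfl; exact hx i (Z.fst_r i)
        obtain ⟨e1, e2⟩ := hoff a hv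
        obtain ⟨e3, e4⟩ := hoff b (fun i => h1 ▸ hv i)
        rw [e1, e2, e3, e4, one_mul, one_mul]
        have hnot : ∀ x : G.Dart, (∀ i, x.fst ≠ (Z.d i).fst) → dartEdge x ∉ C →
            dartEdge x ∉ symmDiff C Z.edges := by
          intro x hx hxC
          have : dartEdge x ∉ Z.edges := by
            rw [Z.mem_edges_iff]
            rintro ⟨i, rfl | rfl⟩
            exacts [hx i rfl, hx i (Z.fst_p i)]
          simp [Set.mem_symmDiff, hxC, this]
        exact ⟨Or.inr ⟨h1, h2, hnot a hv h3, hnot b (fun i => h1 ▸ hv i) h4,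
          fun i hi => absurd hi (hv i)⟩, rfl⟩

end SiteCycle

/-! ### Cancellation of crossed pairings and invariance of the weight -/

/-- Only the entries at `p` and `d` change. Because they square to 1, they gain the factors `A p x *
A p y` and `A d x * A d y`, whose product is 1. The sign of the swap will then make the two terms
cancel. -/
theorem pairProduct_swap_mul {V : Type*} [Fintype V] [DecidableEq V] {G : SimpleGraph V}
    [DecidableRel G.Adj] (ord : SiteOrder G) {A : Matrix G.Dart G.Dart ℂ}
    (hA : ∀ a b, A b a = -A a b) {σ : Equiv.Perm G.Dart} {p d x y : G.Dart}
    (hpd : p ≠ d) (hpy : p ≠ y) (hdx : d ≠ x)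
    (hpx : s(p, x) ∈ pairing ord σ) (hdy : s(d, y) ∈ pairing ord σ)
    (h1 : A p x * A p x = 1) (h2 : A d y * A d y = 1)
    (h : A p x * A p y * (A d x * A d y) = 1) :
    pairProduct ord A (Equiv.swap x y * σ) = pairProduct ord A σ := by
  have hp := ne_of_mem_pairing hpx
  have hd := ne_of_mem_pairing hdy
  have hxp : s(x, p) ∈ pairing ord σ := Sym2.eq_swap (a := p) ▸ hpx
  have hyd : s(y, d) ∈ pairing ord σ := Sym2.eq_swap (a := d) ▸ hdy
  have hxy : x ≠ y := by
    rintro rfl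
    exact hpd (mem_pairing_unique hxp hyd)
  let φ : G.Dart → ℂ := fun z =>
    (if z = p then A p x * A p y else 1) * if z = d then A d x * A d y else 1
  have hφ : ∏ z, φ z = 1 := by
    simp only [φ]
    rw [Finset.prod_mul_distrib, Finset.prod_ite_eq', Finset.prod_ite_eq']
    simpa using h
  have hsp : Equiv.swap x y p = p := Equiv.swap_apply_of_ne_of_ne hp hpy
  have hsd : Equiv.swap x y d = d := Equiv.swap_apply_of_ne_of_ne hdx hd
  have φp : φ p = A p x * A p y := by simp [φ, hpd]
  have φd : φ d = A d x * A d y := by simp [φ, hpd.symm]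
  have φ1 : ∀ z, z ≠ p → z ≠ d → φ z = 1 := fun z hz hz' => by simp [φ, hz, hz']
  have φx := φ1 x hp.symm hdx.symm
  have φy := φ1 y hpy.symm hd.symm
  rw [pairProduct_mul ord A _ σ φ, hφ, one_mul]
  have kp : A (Equiv.swap x y p) (Equiv.swap x y x) = φ p * φ x * A p x := by
    rw [hsp, Equiv.swap_apply_left, φp, φx]
    linear_combination -A p y * h1
  have kd : A (Equiv.swap x y d) (Equiv.swap x y y) = φ d * φ y * A d y := by
    rw [hsd, Equiv.swap_apply_right, φd, φy]
    linear_combination -A d x * h2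
  intro a b hab
  have hba : s(b, a) ∈ pairing ord σ := Sym2.eq_swap (a := a) ▸ hab
  by_cases ap : a = p
  · have hb := mem_pairing_unique hpx (ap ▸ hab)
    rw [ap, ← hb]
    exact kp
  by_cases ax : a = x
  · have hb := mem_pairing_unique hxp (ax ▸ hab)
    rw [ax, ← hb, hA (Equiv.swap x y p), kp, hA p x]
    ring
  by_cases ad : a = d
  · have hb := mem_pairing_unique hdy (ad ▸ hab)
    rw [ad, ← hb]
    exact kd
  by_cases ay : a = y
  · have hb := mem_pairing_unique hyd (ay ▸ hab)
    rw [ay, ← hb, hA (Equiv.swap x y d), kd, hA d y]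
    ring
  have bp : b ≠ p := fun h => ax (mem_pairing_unique hba (h ▸ hpx))
  have bx : b ≠ x := fun h => ap (mem_pairing_unique hba (h ▸ hxp))
  have bd : b ≠ d := fun h => ay (mem_pairing_unique hba (h ▸ hdy))
  have bY : b ≠ y := fun h => ad (mem_pairing_unique hba (h ▸ hyd))
  rw [Equiv.swap_apply_of_ne_of_ne ax ay, Equiv.swap_apply_of_ne_of_ne bx bY, φ1 a ap ad,
    φ1 b bp bd, one_mul, one_mul]

/-- The pairs which occur in the matchings that contribute to the weight of `C`. -/
def IsAllowedPair {V : Type*} {G : SimpleGraph V} (C : Set G.edgeSet) (a b : G.Dart) : Prop :=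
  (b = a.symm ∧ dartEdge a ∈ C) ∨
    (a.fst = b.fst ∧ a ≠ b ∧ dartEdge a ∉ C ∧ dartEdge b ∉ C)

/-- Turns the global conditions on the matching into a condition on single pairs, which can be
followed through a relabelling. -/
theorem isDartMatching_and_curve_iff {V : Type*} [Fintype V] [DecidableEq V] {G : SimpleGraph V}
    (ord : SiteOrder G) (σ : Equiv.Perm G.Dart) (C : Set G.edgeSet) :
    IsDartMatching G (pairing ord σ) ∧ matchingCurve (refMatching ord) (pairing ord σ) = C ↔
      ∀ a b, s(a, b) ∈ pairing ord σ → IsAllowedPair C a b := by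
  rw [isDartMatching_pairing_iff, matchingCurve_eq_iff]
  constructor
  · rintro ⟨h1, h2⟩ a b hab
    by_cases hb : b = a.symm
    · subst hb
      exact Or.inl ⟨rfl, (h2 a).1 hab⟩
    · have hf := (h1 a b hab).resolve_right hb
      refine Or.inr ⟨hf, ne_of_mem_pairing hab, fun ha => ?_, fun hbC => ?_⟩
      · exact hb (mem_pairing_unique hab ((h2 a).2 ha))
      · refine hb ?_
        have hba : s(b, a) ∈ pairing ord σ := Sym2.eq_swap (a := a) ▸ hab
        rw [mem_pairing_unique hba ((h2 b).2 hbC), SimpleGraph.Dart.symm_symm]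
  · intro h
    refine ⟨fun a b hab => ?_, fun d => ⟨fun hd => ?_, fun hd => ?_⟩⟩
    · rcases h a b hab with h | h
      exacts [Or.inr h.1, Or.inl h.1]
    · rcases h _ _ hd with h | h
      exacts [h.2, absurd h.1.symm (fst_symm_ne d)]
    · obtain ⟨b, hb⟩ := exists_mem_pairing ord σ d
      rcases h _ _ hb with h | h
      exacts [h.1 ▸ hb, absurd hd h.2.2.1]

namespace SiteCycle

variable {V : Type*} {G : SimpleGraph V} {n : ℕ} {Z : SiteCycle G n} [Fintype V] [DecidableEq V]

/-- At the vertex `v_i`, which `C` avoids, the pairing matches `p i`, `d i` with the lateral darts. -/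
def IsCrossed (Z : SiteCycle G n) (ord : SiteOrder G) (C : Set G.edgeSet) (σ : Equiv.Perm G.Dart)
    (i : ZMod n) : Prop :=
  dartEdge (Z.q i) ∉ C ∧
    ((s(Z.p i, Z.q i) ∈ pairing ord σ ∧ s(Z.d i, Z.r i) ∈ pairing ord σ) ∨
      (s(Z.p i, Z.r i) ∈ pairing ord σ ∧ s(Z.d i, Z.q i) ∈ pairing ord σ))

/-- An allowed pair fails to be good only by joining `p` or `d` to a lateral dart at a vertex with
free lateral darts. By parity all four darts there are free, and the other two are forced to form
the complementary pair. -/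
theorem exists_isCrossed {ord : SiteOrder G} {C : Set G.edgeSet} (hC : Z.Adapted C)
    {σ : Equiv.Perm G.Dart} (hσ : ∀ a b, s(a, b) ∈ pairing ord σ → IsAllowedPair C a b)
    (hbad : ¬∀ a b, s(a, b) ∈ pairing ord σ → Z.IsGoodPair C a b) :
    ∃ i, Z.IsCrossed ord C σ i := by
  -- a pair joining a dart of the walk to a lateral dart
  have key : ∀ i a b, s(a, b) ∈ pairing ord σ → dartEdge (Z.q i) ∉ C → dartEdge a ∉ C →
      (a = Z.p i ∨ a = Z.d i) → (b = Z.q i ∨ b = Z.r i) → Z.IsCrossed ord C σ i := by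
    intro i a b hab hq haC ha hb
    have hr : dartEdge (Z.r i) ∉ C := mt (hC.q_mem i) hq
    have hpd : dartEdge (Z.p i) ∉ C ∧ dartEdge (Z.d i) ∉ C := by
      have := hC.parity i
      rcases ha with rfl | rfl <;> tauto
    have hother : ∀ x y, s(x, y) ∈ pairing ord σ → (x = Z.p i ∨ x = Z.d i) →
        y = Z.p i ∨ y = Z.d i ∨ y = Z.q i ∨ y = Z.r i := by
      intro x y hxy hx
      refine Z.cover i y ?_
      rcases hσ x y hxy with h | h
      · rcases hx with rfl | rfl
        exacts [absurd h.2 hpd.1, absurd h.2 hpd.2]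
      · rw [← h.1]
        rcases hx with rfl | rfl
        exacts [Z.fst_p i, rfl]
    have hsw : ∀ {x y : G.Dart}, s(x, y) ∈ pairing ord σ → s(y, x) ∈ pairing ord σ :=
      fun {x y} h => Sym2.eq_swap (a := x) ▸ h
    obtain ⟨yp, hyp⟩ := exists_mem_pairing ord σ (Z.p i)
    obtain ⟨yd, hyd⟩ := exists_mem_pairing ord σ (Z.d i)
    have hne : yp ≠ yd := fun h =>
      Z.p_ne_d i (mem_pairing_unique (hsw hyp) (hsw (h ▸ hyd)))
    refine ⟨hq, ?_⟩
    rcases ha with rfl | rfl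
    · obtain rfl := mem_pairing_unique hyp hab
      rcases hother _ _ hyd (Or.inr rfl) with h | h | h | h
      · have := mem_pairing_unique hyp (hsw (h ▸ hyd))
        rcases hb with hb | hb
        · exact absurd (hb.symm.trans this) (Z.d_ne_q i).symm
        · exact absurd (hb.symm.trans this) (Z.d_ne_r i).symm
      · exact absurd h.symm (ne_of_mem_pairing hyd)
      · subst h
        exact Or.inr ⟨(hb.resolve_left hne) ▸ hab, hyd⟩
      · subst h
        exact Or.inl ⟨(hb.resolve_right hne) ▸ hab, hyd⟩
    · obtain rfl := mem_pairing_unique hyd hab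
      rcases hother _ _ hyp (Or.inl rfl) with h | h | h | h
      · exact absurd h.symm (ne_of_mem_pairing hyp)
      · have := mem_pairing_unique hyd (hsw (h ▸ hyp))
        rcases hb with hb | hb
        · exact absurd (hb.symm.trans this) (Z.p_ne_q i).symm
        · exact absurd (hb.symm.trans this) (Z.p_ne_r i).symm
      · subst h
        exact Or.inl ⟨hyp, (hb.resolve_left hne.symm) ▸ hab⟩
      · subst h
        exact Or.inr ⟨hyp, (hb.resolve_right hne.symm) ▸ hab⟩
  push Not at hbad
  obtain ⟨a, b, hab, hgood⟩ := hbad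
  have hba : s(b, a) ∈ pairing ord σ := Sym2.eq_swap (a := a) ▸ hab
  rcases hσ a b hab with h | ⟨h1, h2, h3, h4⟩
  · exact absurd (Or.inl h) hgood
  · have : ∃ i, a.fst = (Z.d i).fst ∧ dartEdge (Z.q i) ∉ C ∧
        ¬((a = Z.p i ∨ a = Z.d i) ↔ (b = Z.p i ∨ b = Z.d i)) := by
      by_contra hcon
      push Not at hcon
      exact hgood (Or.inr ⟨h1, h2, h3, h4, fun i hi hq => by
        have := hcon i hi hq
        tauto⟩)
    obtain ⟨i, hi, hq, hx⟩ := this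
    refine ⟨i, ?_⟩
    have ca := Z.cover i a hi
    have cb := Z.cover i b (h1.symm.trans hi)
    by_cases ha : a = Z.p i ∨ a = Z.d i
    · exact key i a b hab hq h3 ha (by tauto)
    · exact key i b a hba hq h4 (by tauto) (by tauto)

theorem mem_pairing_swap_mul (ord : SiteOrder G) (σ : Equiv.Perm G.Dart) (x y a b : G.Dart) :
    s(a, b) ∈ pairing ord (Equiv.swap x y * σ) ↔
      s(Equiv.swap x y a, Equiv.swap x y b) ∈ pairing ord σ := by
  rw [← mem_pairing_mul ord (Equiv.swap x y) σ, Equiv.swap_apply_self, Equiv.swap_apply_self]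

theorem allowed_swap_mul {ord : SiteOrder G} {C : Set G.edgeSet} (hC : Z.Adapted C)
    {σ : Equiv.Perm G.Dart} (hσ : ∀ a b, s(a, b) ∈ pairing ord σ → IsAllowedPair C a b)
    {i : ZMod n} (hq : dartEdge (Z.q i) ∉ C) (a b : G.Dart)
    (hab : s(a, b) ∈ pairing ord (Equiv.swap (Z.q i) (Z.r i) * σ)) : IsAllowedPair C a b := by
  have hr : dartEdge (Z.r i) ∉ C := mt (hC.q_mem i) hq
  rw [mem_pairing_swap_mul] at hab
  have hfst : ∀ x, (Equiv.swap (Z.q i) (Z.r i) x).fst = x.fst := by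
    intro x
    by_cases h1 : x = Z.q i
    · rw [h1, Equiv.swap_apply_left, Z.fst_q, Z.fst_r]
    by_cases h2 : x = Z.r i
    · rw [h2, Equiv.swap_apply_right, Z.fst_q, Z.fst_r]
    rw [Equiv.swap_apply_of_ne_of_ne h1 h2]
  have hmem : ∀ x, dartEdge (Equiv.swap (Z.q i) (Z.r i) x) ∈ C ↔ dartEdge x ∈ C := by
    intro x
    by_cases h1 : x = Z.q i
    · rw [h1, Equiv.swap_apply_left]
      exact iff_of_false hr hq
    by_cases h2 : x = Z.r i
    · rw [h2, Equiv.swap_apply_right]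
      exact iff_of_false hq hr
    rw [Equiv.swap_apply_of_ne_of_ne h1 h2]
  have hfix : ∀ x, dartEdge x ∈ C → Equiv.swap (Z.q i) (Z.r i) x = x := fun x hx =>
    Equiv.swap_apply_of_ne_of_ne (by rintro rfl; exact hq hx) (by rintro rfl; exact hr hx)
  rcases hσ _ _ hab with ⟨h1, h2⟩ | ⟨h1, h2, h3, h4⟩
  · rw [hmem] at h2
    rw [hfix a h2] at h1
    refine Or.inl ⟨?_, h2⟩
    rw [Equiv.swap_apply_eq_iff] at h1
    rw [h1, hfix]
    rwa [dartEdge_symm]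
  · rw [hfst, hfst] at h1
    rw [hmem] at h3 h4
    exact Or.inr ⟨h1, fun h => h2 (by rw [h]), h3, h4⟩

/-- The swap exchanges the two crossed pairings at `v_i` and leaves the other vertices alone. The
set of crossed vertices is thus an invariant of the involution below. -/
theorem isCrossed_swap_mul {ord : SiteOrder G} {C : Set G.edgeSet} {σ : Equiv.Perm G.Dart}
    (i j : ZMod n) : Z.IsCrossed ord C (Equiv.swap (Z.q i) (Z.r i) * σ) j ↔
      Z.IsCrossed ord C σ j := by
  simp only [IsCrossed, mem_pairing_swap_mul]
  refine and_congr_right fun _ => ?_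
  rw [Equiv.swap_apply_of_ne_of_ne (Z.q_ne_p' i j).symm (Z.p_ne_r' j i),
    Equiv.swap_apply_of_ne_of_ne (Z.q_ne_d' i j).symm (Z.d_ne_r' j i)]
  by_cases h : i = j
  · subst h
    rw [Equiv.swap_apply_left, Equiv.swap_apply_right]
    exact or_comm
  · have hne : Z.q j ≠ Z.q i := fun e => h (Z.idx (by rw [← Z.fst_q, ← e, Z.fst_q]))
    rw [Equiv.swap_apply_of_ne_of_ne hne (Z.q_ne_r' j i),
      Equiv.swap_apply_of_ne_of_ne (Z.q_ne_r' i j).symm fun e => h (Z.r_inj e).symm]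

variable [DecidableRel G.Adj] [NeZero n]

open Classical in
theorem sum_allowed_eq_sum_good (ord : SiteOrder G) {A : Matrix G.Dart G.Dart ℂ} {t : ZMod n → ℂ}
    (hA : Z.Flat A t) {C : Set G.edgeSet} (hC : Z.Adapted C) :
    ∑ σ : Equiv.Perm G.Dart with ∀ a b, s(a, b) ∈ pairing ord σ → IsAllowedPair C a b,
        ((Equiv.Perm.sign σ : ℤ) : ℂ) * pairProduct ord A σ =
      ∑ σ : Equiv.Perm G.Dart with ∀ a b, s(a, b) ∈ pairing ord σ → Z.IsGoodPair C a b,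
        ((Equiv.Perm.sign σ : ℤ) : ℂ) * pairProduct ord A σ := by
  rw [← Finset.sum_filter_add_sum_filter_not _
    (fun σ => ∀ a b, s(a, b) ∈ pairing ord σ → Z.IsGoodPair C a b), Finset.filter_filter,
    Finset.filter_filter]
  have hbad : ∑ σ : Equiv.Perm G.Dart with
      (∀ a b, s(a, b) ∈ pairing ord σ → IsAllowedPair C a b) ∧
      ¬∀ a b, s(a, b) ∈ pairing ord σ → Z.IsGoodPair C a b,
        ((Equiv.Perm.sign σ : ℤ) : ℂ) * pairProduct ord A σ = 0 := by
    -- The vertex is chosen from the set of crossed vertices alone, so that applying the swap twice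
    -- uses the same vertex. The default 0 plays no role for bad `σ`, whose set is nonempty.
    let pick : Set (ZMod n) → ZMod n := fun S => if h : S.Nonempty then h.some else 0
    let g : Equiv.Perm G.Dart → ZMod n := fun σ => pick {i | Z.IsCrossed ord C σ i}
    have hg : ∀ σ i, g (Equiv.swap (Z.q i) (Z.r i) * σ) = g σ := by
      intro σ i
      simp only [g, isCrossed_swap_mul]
    have hcr : ∀ σ : Equiv.Perm G.Dart,
        (∀ a b, s(a, b) ∈ pairing ord σ → IsAllowedPair C a b) →
        (¬∀ a b, s(a, b) ∈ pairing ord σ → Z.IsGoodPair C a b) →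
        Z.IsCrossed ord C σ (g σ) := by
      intro σ h1 h2
      have hne : {i | Z.IsCrossed ord C σ i}.Nonempty := exists_isCrossed hC h1 h2
      have : g σ = hne.some := by simp only [g, pick, dif_pos hne]
      rw [this]
      exact hne.some_mem
    refine Finset.sum_involution (fun σ _ => Equiv.swap (Z.q (g σ)) (Z.r (g σ)) * σ) ?_ ?_ ?_ ?_
    · intro σ hσ
      simp only [Finset.mem_filter, Finset.mem_univ, true_and] at hσ
      have hx := hcr σ hσ.1 hσ.2
      set i := g σ
      have hpq := hA.sq _ _ ((Z.fst_p i).trans (Z.fst_q i).symm) (Z.p_ne_q i)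
      have hpr := hA.sq _ _ ((Z.fst_p i).trans (Z.fst_r i).symm) (Z.p_ne_r i)
      have hdq := hA.sq _ _ (Z.fst_q i).symm (Z.d_ne_q i)
      have hdr := hA.sq _ _ (Z.fst_r i).symm (Z.d_ne_r i)
      have hpd := hA.sq _ _ (Z.fst_p i) (Z.p_ne_d i)
      -- This is `S S̄ + T T̄ = 0` in multiplicative form: the product of the two triangle
      -- equations.
      have h4 : A (Z.p i) (Z.q i) * A (Z.p i) (Z.r i) * (A (Z.d i) (Z.q i) * A (Z.d i) (Z.r i)) =
          1 := by
        have h1 := hA.tri_q i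
        have h2 := hA.tri_r i
        have h3 := hA.t_sq i
        rw [← h1] at h2
        linear_combination -(A (Z.p i) (Z.q i) * A (Z.p i) (Z.r i) *
          (A (Z.d i) (Z.q i) * A (Z.d i) (Z.r i))) * hpd +
          A (Z.p i) (Z.d i) * A (Z.p i) (Z.q i) * A (Z.d i) (Z.q i) * h2 +
          A (Z.p i) (Z.d i) * A (Z.p i) (Z.d i) * A (Z.p i) (Z.q i) * A (Z.p i) (Z.q i) * hdq +
          A (Z.p i) (Z.d i) * A (Z.p i) (Z.d i) * hpq + hpd
      have hprod : pairProduct ord A (Equiv.swap (Z.q i) (Z.r i) * σ) = pairProduct ord A σ := by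
        rcases hx.2 with ⟨h1, h2⟩ | ⟨h1, h2⟩
        · exact pairProduct_swap_mul ord hA.antisymm (Z.p_ne_d i) (Z.p_ne_r i) (Z.d_ne_q i) h1 h2
            hpq hdr h4
        · rw [Equiv.swap_comm]
          exact pairProduct_swap_mul ord hA.antisymm (Z.p_ne_d i) (Z.p_ne_q i) (Z.d_ne_r i) h1 h2
            hpr hdq (by linear_combination h4)
      rw [hprod, Equiv.Perm.sign_mul, Equiv.Perm.sign_swap (Z.q_ne_r i)]
      push_cast
      ring
    · intro σ hσ _ h
      exact Z.q_ne_r _ (Equiv.swap_eq_one_iff.1 (mul_eq_right.1 h))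
    · intro σ hσ
      simp only [Finset.mem_filter, Finset.mem_univ, true_and] at hσ ⊢
      have hx := hcr σ hσ.1 hσ.2
      refine ⟨allowed_swap_mul hC hσ.1 hx.1, fun hgood => ?_⟩
      have hx' := (isCrossed_swap_mul (g σ) (g σ)).2 hx
      have hcross : ∀ b, (b = Z.q (g σ) ∨ b = Z.r (g σ)) → ¬Z.IsGoodPair C (Z.p (g σ)) b := by
        rintro b hb (h | h)
        · refine (fst_symm_ne (Z.p (g σ))) ?_
          rw [← h.1, Z.fst_p]
          rcases hb with rfl | rfl
          exacts [Z.fst_q _, Z.fst_r _]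
        · have := (h.2.2.2.2 (g σ) (Z.fst_p _) hx.1).1 (Or.inl rfl)
          rcases hb with rfl | rfl
          · exact this.elim (Z.q_ne_p' _ _) (Z.q_ne_d' _ _)
          · exact this.elim (Z.p_ne_r _).symm (Z.d_ne_r _).symm
      rcases hx'.2 with h | h
      · exact hcross _ (Or.inl rfl) (hgood _ _ h.1)
      · exact hcross _ (Or.inr rfl) (hgood _ _ h.1)
    · intro σ hσ
      simp only [hg, Equiv.swap_mul_self_mul]
  rw [hbad, add_zero]
  refine Finset.sum_congr (Finset.filter_congr fun σ _ => ?_) fun _ _ => rfl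
  refine ⟨fun h => h.2, fun h => ⟨fun a b hab => ?_, h⟩⟩
  rcases h a b hab with h | h
  exacts [Or.inl h, Or.inr ⟨h.1, h.2.1, h.2.2.1, h.2.2.2.1⟩]

open Classical in
-- Surjectivity comes from counting: the rotation for `C ∆ γ` gives the opposite inequality of
-- cardinalities, so the inverse of `ρ` need not be examined.
theorem sum_good_symmDiff (ord : SiteOrder G) {A : Matrix G.Dart G.Dart ℂ} {t : ZMod n → ℂ}
    (hA : Z.Flat A t) {C : Set G.edgeSet} (hC : Z.Adapted C) :
    ∑ σ : Equiv.Perm G.Dart with ∀ a b, s(a, b) ∈ pairing ord σ → Z.IsGoodPair C a b,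
        ((Equiv.Perm.sign σ : ℤ) : ℂ) * pairProduct ord A σ =
      ∑ σ : Equiv.Perm G.Dart with
          ∀ a b, s(a, b) ∈ pairing ord σ → Z.IsGoodPair (symmDiff C Z.edges) a b,
        ((Equiv.Perm.sign σ : ℤ) : ℂ) * pairProduct ord A σ := by
  let S : Set G.edgeSet → Finset (Equiv.Perm G.Dart) := fun C =>
    Finset.univ.filter fun σ => ∀ a b, s(a, b) ∈ pairing ord σ → Z.IsGoodPair C a b
  have hmaps : ∀ {C : Set G.edgeSet}, Z.Adapted C → ∃ ρ : Equiv.Perm G.Dart,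
      (∀ σ ∈ S C, ρ * σ ∈ S (symmDiff C Z.edges)) ∧
      ∀ σ ∈ S C, ((Equiv.Perm.sign (ρ * σ) : ℤ) : ℂ) * pairProduct ord A (ρ * σ) =
        ((Equiv.Perm.sign σ : ℤ) : ℂ) * pairProduct ord A σ := by
    intro C hC
    obtain ⟨ρ, φ, h1, h2⟩ := exists_shift hA hC
    refine ⟨ρ, fun σ hσ => ?_, fun σ hσ => ?_⟩
    · simp only [S, Finset.mem_filter, Finset.mem_univ, true_and] at hσ ⊢
      intro a b hab
      obtain ⟨a, rfl⟩ := ρ.surjective a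
      obtain ⟨b, rfl⟩ := ρ.surjective b
      exact (h2 a b (hσ a b ((mem_pairing_mul ..).1 hab))).1
    · simp only [S, Finset.mem_filter, Finset.mem_univ, true_and] at hσ
      rw [pairProduct_mul ord A ρ σ φ fun a b hab => (h2 a b (hσ a b hab)).2,
        Equiv.Perm.sign_mul]
      push_cast
      linear_combination ((Equiv.Perm.sign σ : ℤ) : ℂ) * pairProduct ord A σ * h1
  have hcard : ∀ {C : Set G.edgeSet}, Z.Adapted C →
      (S C).card ≤ (S (symmDiff C Z.edges)).card := by
    intro C hC
    obtain ⟨ρ, h1, -⟩ := hmaps hC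
    exact Finset.card_le_card_of_injOn (fun σ => ρ * σ) h1 (mul_right_injective ρ).injOn
  have hcard' := hcard hC.symmDiff
  rw [symmDiff_symmDiff_cancel_right] at hcard'
  obtain ⟨ρ, h1, h2⟩ := hmaps hC
  refine Finset.sum_bij (fun σ _ => ρ * σ) h1 (fun σ _ τ _ h => mul_right_injective ρ h) ?_
    fun σ hσ => (h2 σ hσ).symm
  intro τ hτ
  obtain ⟨σ, hσ, h⟩ := Finset.surj_on_of_inj_on_of_card_le (fun σ _ => ρ * σ) h1
    (fun σ τ _ _ h => mul_right_injective ρ h) hcard' τ hτ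
  exact ⟨σ, hσ, h.symm⟩

theorem curveWeight_symmDiff (ord : SiteOrder G) {A : Matrix G.Dart G.Dart ℂ} {t : ZMod n → ℂ}
    (hA : Z.Flat A t) {C : Set G.edgeSet} (hC : Z.Adapted C) :
    curveWeight ord A (refMatching ord) C =
      curveWeight ord A (refMatching ord) (symmDiff C Z.edges) := by
  classical
  simp only [curveWeight_eq_sum, isDartMatching_and_curve_iff]
  rw [sum_allowed_eq_sum_good ord hA hC, sum_allowed_eq_sum_good ord hA hC.symmDiff,
    sum_good_symmDiff ord hA hC]

end SiteCycle

namespace SiteCycle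

variable {V : Type*} {G : SimpleGraph V} {n : ℕ}

theorem parity_of_isClosedCurve (Z : SiteCycle G n) {C : Set G.edgeSet}
    (hC : IsClosedCurve G C) (i : ZMod n) :
    (dartEdge (Z.p i) ∈ C ↔ dartEdge (Z.d i) ∈ C) ↔
      (dartEdge (Z.q i) ∈ C ↔ dartEdge (Z.r i) ∈ C) := by
  classical
  have h := hC (Z.d i).fst
  have hset : {x : G.Dart | x.fst = (Z.d i).fst ∧ dartEdge x ∈ C} =
      (({Z.p i, Z.d i, Z.q i, Z.r i} : Finset G.Dart).filter fun x => dartEdge x ∈ C :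
        Finset G.Dart) := by
    ext x
    simp only [Set.mem_ofPred_eq, Finset.coe_filter, Finset.mem_insert, Finset.mem_singleton]
    refine and_congr_left fun _ => ⟨Z.cover i x, ?_⟩
    rintro (rfl | rfl | rfl | rfl)
    exacts [Z.fst_p i, rfl, Z.fst_q i, Z.fst_r i]
  rw [hset, Set.ncard_coe_finset, Finset.card_filter,
    Finset.sum_insert (by simp [Z.p_ne_d, Z.p_ne_q, Z.p_ne_r]),
    Finset.sum_insert (by simp [Z.d_ne_q, Z.d_ne_r]),
    Finset.sum_insert (by simp [Z.q_ne_r]), Finset.sum_singleton] at h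
  by_cases h1 : dartEdge (Z.p i) ∈ C <;> by_cases h2 : dartEdge (Z.d i) ∈ C <;>
    by_cases h3 : dartEdge (Z.q i) ∈ C <;> by_cases h4 : dartEdge (Z.r i) ∈ C <;>
    simp only [h1, h2, h3, h4, if_true, if_false, iff_self, iff_true, iff_false, not_true] at h ⊢ <;>
    revert h <;> decide

/-- The same walk, with the lateral darts renamed at the vertices where `s` holds. -/
def rename (Z : SiteCycle G n) (s : ZMod n → Prop) [DecidablePred s] : SiteCycle G n where
  p := Z.p
  d := Z.d
  q i := if s i then Z.r i else Z.q i
  r i := if s i then Z.q i else Z.r i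
  p_succ := Z.p_succ
  fst_p := Z.fst_p
  fst_q i := by split_ifs; exacts [Z.fst_r i, Z.fst_q i]
  fst_r i := by split_ifs; exacts [Z.fst_q i, Z.fst_r i]
  inj := Z.inj
  cover i x hx := by
    have := Z.cover i x hx
    split_ifs <;> tauto
  p_ne_d := Z.p_ne_d
  p_ne_q i := by split_ifs; exacts [Z.p_ne_r i, Z.p_ne_q i]
  p_ne_r i := by split_ifs; exacts [Z.p_ne_q i, Z.p_ne_r i]
  d_ne_q i := by split_ifs; exacts [Z.d_ne_r i, Z.d_ne_q i]
  d_ne_r i := by split_ifs; exacts [Z.d_ne_q i, Z.d_ne_r i]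
  q_ne_r i := by split_ifs; exacts [(Z.q_ne_r i).symm, Z.q_ne_r i]

/-- Renaming the lateral darts where `r i` is in `C` makes `C` adapted. Flatness survives because
the triangle equations are symmetric in `q` and `r`. -/
theorem curveWeight_symmDiff_of_isClosedCurve [Fintype V] [DecidableEq V] [DecidableRel G.Adj]
    [NeZero n] (Z : SiteCycle G n) (ord : SiteOrder G) {A : Matrix G.Dart G.Dart ℂ}
    {t : ZMod n → ℂ} (hA : Z.Flat A t) {C : Set G.edgeSet} (hC : IsClosedCurve G C) :
    curveWeight ord A (refMatching ord) C =
      curveWeight ord A (refMatching ord) (symmDiff C Z.edges) := by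
  classical
  let Z' := Z.rename fun i => dartEdge (Z.r i) ∈ C
  have hA' : Z'.Flat A t :=
    { hA with
      tri_q := fun i => by
        simp only [Z', rename]
        split_ifs
        exacts [hA.tri_r i, hA.tri_q i]
      tri_r := fun i => by
        simp only [Z', rename]
        split_ifs
        exacts [hA.tri_q i, hA.tri_r i] }
  refine curveWeight_symmDiff (Z := Z') ord hA' ⟨Z'.parity_of_isClosedCurve hC, fun i => ?_⟩
  simp only [Z', rename]
  split_ifs with h
  · exact fun _ => h
  · exact fun h' => absurd h' h

end SiteCycle

/-! ### Face tracing -/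

namespace EmbeddingScheme

variable {V : Type*} {G : SimpleGraph V} (X : EmbeddingScheme G)

theorem fst_rot_symm (d : G.Dart) : (X.rot.symm d).fst = d.fst := by
  have := X.fst_rot (X.rot.symm d)
  rwa [Equiv.apply_symm_apply, eq_comm] at this

theorem fst_rot_zpow (s : ℤˣ) (d : G.Dart) : ((X.rot ^ (s : ℤ)) d).fst = d.fst := by
  rcases Int.units_eq_one_or s with rfl | rfl
  · simpa using X.fst_rot d
  · simpa using X.fst_rot_symm d

/-- A numbering of the darts at each vertex, modulo four, along the rotation. -/
structure IsNumbering (idx : G.Dart → ZMod 4) : Prop where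
  rot : ∀ d, idx (X.rot d) = idx d + 1
  inj : ∀ d d', d.fst = d'.fst → idx d = idx d' → d = d'

/-- A dart is numbered by the power of the rotation that carries a base dart to it; the rotation has
order four at each vertex. -/
theorem exists_numbering [Fintype V] [DecidableEq V] [DecidableRel G.Adj]
    (hreg : G.IsRegularOfDegree 4) : ∃ idx, X.IsNumbering idx := by
  have hcard : ∀ v, (Finset.univ.filter fun d : G.Dart => d.fst = v).card = 4 := fun v => by
    rw [← hreg v]
    exact G.dart_fst_fiber_card_eq_degree v
  have hne : ∀ v, ∃ d : G.Dart, d.fst = v := fun v => by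
    have : (Finset.univ.filter fun d : G.Dart => d.fst = v).Nonempty := by
      rw [← Finset.card_pos, hcard]
      norm_num
    obtain ⟨d, hd⟩ := this
    exact ⟨d, by simpa using hd⟩
  choose b hb using hne
  have hcyc : ∀ v, X.rot.IsCycleOn
      ((Finset.univ.filter fun d : G.Dart => d.fst = v : Finset G.Dart) : Set G.Dart) := by
    intro v
    refine ⟨⟨fun d hd => ?_, X.rot.injective.injOn, fun d hd => ?_⟩, fun d hd d' hd' => ?_⟩
    · simpa [X.fst_rot] using hd
    · exact ⟨X.rot.symm d, by simpa [X.fst_rot_symm] using hd, by simp⟩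
    · simp only [Finset.coe_filter, Finset.mem_univ, true_and, Set.mem_ofPred_eq] at hd hd'
      exact X.sameCycle_rot d d' (hd.trans hd'.symm)
  have hz : ∀ d : G.Dart, ∃ z : ℤ, (X.rot ^ z) (b d.fst) = d := fun d =>
    X.sameCycle_rot _ _ (hb _)
  choose z hz using hz
  have key : ∀ (v : V) (m k : ℤ), (X.rot ^ m) (b v) = (X.rot ^ k) (b v) ↔
      ((m : ℤ) : ZMod 4) = k := by
    intro v m k
    rw [(hcyc v).zpow_apply_eq_zpow_apply (by simp [hb]), hcard, ← ZMod.intCast_eq_intCast_iff]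
  refine ⟨fun d => (z d : ZMod 4), fun d => ?_, fun d d' h h' => ?_⟩
  · have h1 := hz (X.rot d)
    rw [X.fst_rot] at h1
    have h2 : (X.rot ^ (z d + 1)) (b d.fst) = X.rot d := by
      rw [add_comm, zpow_add, zpow_one, Equiv.Perm.mul_apply, hz]
    have := (key d.fst _ _).1 (h1.trans h2.symm)
    simpa using this
  · rw [← hz d, ← hz d', ← h]
    exact (key d.fst _ _).2 h'

variable {X} in
theorem IsNumbering.zpow {idx : G.Dart → ZMod 4} (h : X.IsNumbering idx) (s : ℤˣ) (d : G.Dart) :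
    idx ((X.rot ^ (s : ℤ)) d) = idx d + ((s : ℤ) : ZMod 4) := by
  rcases Int.units_eq_one_or s with rfl | rfl
  · simpa using h.rot d
  · have := h.rot (X.rot.symm d)
    rw [Equiv.apply_symm_apply] at this
    simp [this]

theorem faceStep_injective : Function.Injective X.faceStep := by
  rintro ⟨d, s⟩ ⟨d', s'⟩ h
  simp only [faceStep, Prod.mk.injEq] at h
  obtain ⟨h1, h2⟩ := h
  rw [h2] at h1
  have h3 := (X.rot ^ _).injective h1
  have h4 : d = d' := SimpleGraph.Dart.symm_involutive.injective h3
  subst h4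
  exact Prod.ext rfl (mul_right_cancel h2)

theorem faceStep_zpow (d : G.Dart) (s : ℤˣ) :
    X.faceStep (((X.rot ^ (-(s : ℤ))) d).symm, s * X.sgn (dartEdge ((X.rot ^ (-(s : ℤ))) d))) =
      (d, s) := by
  have hs : X.sgn (dartEdge ((X.rot ^ (-(s : ℤ))) d)) *
      X.sgn (dartEdge ((X.rot ^ (-(s : ℤ))) d)) = 1 := Int.units_mul_self _
  simp only [faceStep, dartEdge_symm, mul_assoc, hs, mul_one, SimpleGraph.Dart.symm_symm]
  rw [← Equiv.Perm.mul_apply, ← zpow_add, add_neg_cancel, zpow_zero, Equiv.Perm.one_apply]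

/-- The state which traverses the same edge of the same face backwards. -/
def reverse (x : G.Dart × ℤˣ) : G.Dart × ℤˣ := (x.1.symm, -(x.2 * X.sgn (dartEdge x.1)))

theorem reverse_reverse (x : G.Dart × ℤˣ) : X.reverse (X.reverse x) = x := by
  have hs : X.sgn (dartEdge x.1) * X.sgn (dartEdge x.1) = 1 := Int.units_mul_self _
  refine Prod.ext (SimpleGraph.Dart.symm_symm _) ?_
  simp only [reverse, dartEdge_symm, neg_mul, neg_neg, mul_assoc, hs, mul_one]

/-- Reversal conjugates a step of face tracing into the inverse step, so both directions along a
face give the same boundary. -/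
theorem faceStep_reverse_faceStep (x : G.Dart × ℤˣ) :
    X.faceStep (X.reverse (X.faceStep x)) = X.reverse x := by
  have h := X.faceStep_zpow x.1.symm (-(x.2 * X.sgn (dartEdge x.1)))
  simp only [Units.val_neg, neg_neg] at h
  rw [neg_mul] at h
  exact h

theorem mem_facialWalk_self (x : G.Dart × ℤˣ) : x ∈ X.facialWalk x := ⟨0, rfl⟩

theorem mem_faceBoundary_self (x : G.Dart × ℤˣ) : dartEdge x.1 ∈ X.faceBoundary x :=
  ⟨x, X.mem_facialWalk_self x, rfl⟩

section Finite

variable [Finite V]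

theorem finite_state : Finite (G.Dart × ℤˣ) := by
  have : Finite G.Dart := Finite.of_injective _ SimpleGraph.Dart.toProd_injective
  infer_instance

/-- There are finitely many states and the step is injective. Hence `x` is periodic and recurs in
the walk started one step later. -/
theorem facialWalk_faceStep (x : G.Dart × ℤˣ) : X.facialWalk (X.faceStep x) = X.facialWalk x := by
  have := finite_state (G := G)
  obtain ⟨m, hm, hx⟩ := Function.Injective.mem_periodicPts X.faceStep_injective x
  have hx' : X.faceStep^[m] x = x := hx
  ext y
  constructor
  · rintro ⟨k, rfl⟩
    exact ⟨k + 1, Function.iterate_succ_apply _ _ _⟩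
  · rintro ⟨k, rfl⟩
    refine ⟨k + (m - 1), ?_⟩
    change X.faceStep^[k + (m - 1)] (X.faceStep x) = _
    rw [← Function.iterate_succ_apply, Nat.succ_eq_add_one,
      show k + (m - 1) + 1 = k + m by omega, Function.iterate_add_apply, hx']

theorem facialWalk_eq_of_mem {x y : G.Dart × ℤˣ} (h : y ∈ X.facialWalk x) :
    X.facialWalk y = X.facialWalk x := by
  obtain ⟨k, rfl⟩ := h
  change X.facialWalk (X.faceStep^[k] x) = _
  induction k with
  | zero => rfl
  | succ k ih => rw [Function.iterate_succ_apply', facialWalk_faceStep, ih]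

theorem faceBoundary_faceStep (x : G.Dart × ℤˣ) :
    X.faceBoundary (X.faceStep x) = X.faceBoundary x := by
  rw [faceBoundary, faceBoundary, facialWalk_faceStep]

theorem faceBoundary_reverse_subset (x : G.Dart × ℤˣ) :
    X.faceBoundary (X.reverse x) ⊆ X.faceBoundary x := by
  have h : ∀ k : ℕ, X.reverse (X.faceStep^[k] x) ∈ X.facialWalk (X.reverse x) ∧
      dartEdge (X.faceStep^[k] x).1 ∈ X.faceBoundary x := fun k => by
    refine ⟨?_, _, ⟨k, rfl⟩, rfl⟩
    induction k with
    | zero => exact mem_facialWalk_self ..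
    | succ k ih =>
      rw [← X.facialWalk_eq_of_mem ih, Function.iterate_succ_apply']
      have := X.facialWalk_faceStep (X.reverse (X.faceStep (X.faceStep^[k] x)))
      rw [faceStep_reverse_faceStep] at this
      rw [this]
      exact mem_facialWalk_self ..
  -- the reversed states of the walk are closed under a step
  rintro _ ⟨y, hy, rfl⟩
  -- A step of the reversed walk is a step backwards in the original one, which by periodicity is
  -- again a forward iterate.
  have hsub : ∀ j : ℕ, ∃ k : ℕ, X.faceStep^[j] (X.reverse x) = X.reverse (X.faceStep^[k] x) := by
    intro j
    induction j with
    | zero => exact ⟨0, rfl⟩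
    | succ j ih =>
      obtain ⟨k, hk⟩ := ih
      have hmem : X.faceStep^[k] x ∈ X.facialWalk (X.faceStep x) := by
        rw [facialWalk_faceStep]
        exact ⟨k, rfl⟩
      obtain ⟨l, hl⟩ := hmem
      refine ⟨l, ?_⟩
      rw [Function.iterate_succ_apply', hk, ← hl]
      change X.faceStep (X.reverse (X.faceStep^[l] (X.faceStep x))) = _
      rw [← Function.iterate_succ_apply, Function.iterate_succ_apply', faceStep_reverse_faceStep]
  obtain ⟨j, rfl⟩ := hy
  obtain ⟨k, hk⟩ := hsub j
  change dartEdge (X.faceStep^[j] (X.reverse x)).1 ∈ _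
  rw [hk]
  simp only [reverse, dartEdge_symm]
  exact (h k).2

theorem faceBoundary_reverse (x : G.Dart × ℤˣ) :
    X.faceBoundary (X.reverse x) = X.faceBoundary x := by
  refine (X.faceBoundary_reverse_subset x).antisymm ?_
  conv_lhs => rw [← X.reverse_reverse x]
  exact X.faceBoundary_reverse_subset _

theorem mem_faceBoundary_prev (d : G.Dart) (s : ℤˣ) :
    dartEdge ((X.rot ^ (-(s : ℤ))) d) ∈ X.faceBoundary (d, s) := by
  have h := X.mem_faceBoundary_self
    (((X.rot ^ (-(s : ℤ))) d).symm, s * X.sgn (dartEdge ((X.rot ^ (-(s : ℤ))) d)))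
  rw [← faceBoundary_faceStep, faceStep_zpow] at h
  rwa [dartEdge_symm] at h

/-- The faces incident with the edge of `d` are the two on its sides. -/
theorem faceBoundary_eq_of_mem (d : G.Dart) {x : G.Dart × ℤˣ}
    (h : dartEdge d ∈ X.faceBoundary x) :
    X.faceBoundary x = X.faceBoundary (d, 1) ∨ X.faceBoundary x = X.faceBoundary (d, -1) := by
  obtain ⟨⟨d', s⟩, hy, hd⟩ := h
  have hx : X.faceBoundary x = X.faceBoundary (d', s) := by
    rw [faceBoundary, faceBoundary, X.facialWalk_eq_of_mem hy]
  have key : ∀ s, X.faceBoundary (d, s) = X.faceBoundary (d, 1) ∨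
      X.faceBoundary (d, s) = X.faceBoundary (d, -1) := fun s => by
    rcases Int.units_eq_one_or s with rfl | rfl
    exacts [Or.inl rfl, Or.inr rfl]
  rw [hx]
  rcases dartEdge_eq_iff.1 hd with h | h
  · simp only at h
    rw [h]
    exact key s
  · simp only at h
    have h2 := X.faceBoundary_reverse (d', s)
    rw [reverse, h, SimpleGraph.Dart.symm_symm] at h2
    rw [h, ← h2]
    exact key _

variable {X} in
-- The walk is indexed by one minimal period of `faceStep`, and strongness makes its vertices
-- distinct. At each vertex `p`, `d`, `q`, `r` follow each other along the rotation in the sense `t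
-- i`.
theorem exists_siteCycle (hX : X.IsStrong) {idx : G.Dart → ZMod 4} (hidx : X.IsNumbering idx)
    (x : G.Dart × ℤˣ) :
    ∃ (n : ℕ) (_ : NeZero n) (Z : SiteCycle G n) (t : ZMod n → ℤˣ), 3 ≤ n ∧
      Z.edges = X.faceBoundary x ∧ (∀ i, Z.d i = (X.rot ^ (t i : ℤ)) (Z.p i)) ∧
      (∀ i, t (i + 1) = t i * X.sgn (dartEdge (Z.d i))) ∧ ∃ i, Z.d i = x.1 ∧ t i = x.2 := by
  have := finite_state (G := G)
  have hper := Function.Injective.mem_periodicPts X.faceStep_injective x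
  set n := Function.minimalPeriod X.faceStep x with hn
  have hpos : 0 < n := Function.minimalPeriod_pos_of_mem_periodicPts hper
  have hz : NeZero n := ⟨hpos.ne'⟩
  let y : ZMod n → G.Dart × ℤˣ := fun i => X.faceStep^[i.val] x
  have ynat : ∀ k : ℕ, y (k : ZMod n) = X.faceStep^[k] x := fun k => by
    simp only [y]
    rw [ZMod.val_natCast, hn, Function.iterate_mod_minimalPeriod_eq]
  have ysucc : ∀ i, y (i + 1) = X.faceStep (y i) := fun i => by
    rw [← Function.iterate_succ_apply' X.faceStep i.val x, ← ynat]
    simp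
  have ymem : ∀ i, y i ∈ X.facialWalk x := fun i => ⟨i.val, rfl⟩
  have yinj : Function.Injective y := fun i j h =>
    ZMod.val_injective n <| Function.iterate_injOn_Iio_minimalPeriod
      (Set.mem_Iio.2 (ZMod.val_lt i)) (Set.mem_Iio.2 (ZMod.val_lt j)) h
  have hinj : Function.Injective fun i => (y i).1.fst := fun i j h =>
    yinj (hX x (ymem i) (ymem j) h)
  have hstep : ∀ i, (y (i + 1)).1 = (X.rot ^ ((y (i + 1)).2 : ℤ)) (y i).1.symm := fun i => by
    rw [ysucc]
    rfl
  let p : ZMod n → G.Dart := fun i => (y (i - 1)).1.symm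
  have hp : ∀ i, (y i).1 = (X.rot ^ ((y i).2 : ℤ)) (p i) := fun i => by
    have := hstep (i - 1)
    rwa [sub_add_cancel] at this
  have ip : ∀ i, idx (y i).1 = idx (p i) + (((y i).2 : ℤ) : ZMod 4) := fun i => by
    conv_lhs => rw [hp i]
    exact hidx.zpow _ _
  let q : ZMod n → G.Dart := fun i => (X.rot ^ ((y i).2 : ℤ)) (y i).1
  have iq : ∀ i, idx (q i) = idx (y i).1 + (((y i).2 : ℤ) : ZMod 4) := fun i => hidx.zpow _ _
  let r : ZMod n → G.Dart := fun i => (X.rot ^ ((y i).2 : ℤ)) (q i)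
  have ir : ∀ i, idx (r i) = idx (q i) + (((y i).2 : ℤ) : ZMod 4) := fun i => hidx.zpow _ _
  have fp : ∀ i, (p i).fst = (y i).1.fst := fun i => by
    conv_rhs => rw [hp i]
    exact (X.fst_rot_zpow _ _).symm
  have fq : ∀ i, (q i).fst = (y i).1.fst := fun i => X.fst_rot_zpow _ _
  have fr : ∀ i, (r i).fst = (y i).1.fst := fun i => (X.fst_rot_zpow _ _).trans (fq i)
  have hs4 : ∀ s : ℤˣ, ((s : ℤ) : ZMod 4) = 1 ∨ ((s : ℤ) : ZMod 4) = -1 :=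
    fun s => by rcases Int.units_eq_one_or s with rfl | rfl <;> simp
  have ne_of : ∀ {a b : G.Dart}, idx a ≠ idx b → a ≠ b := fun {a b} h e => h (by rw [e])
  have dec : ∀ a s : ZMod 4, (s = 1 ∨ s = -1) → a ≠ a + s ∧ a ≠ a + s + s ∧ a ≠ a + s + s + s ∧
      ∀ b, b = a ∨ b = a + s ∨ b = a + s + s ∨ b = a + s + s + s := by decide
  let Z : SiteCycle G n :=
    { p := p
      d := fun i => (y i).1
      q := q
      r := r
      p_succ := fun i => by simp only [p, add_sub_cancel_right]
      fst_p := fp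
      fst_q := fq
      fst_r := fr
      inj := hinj
      cover := fun i x hx => by
        have h := (dec (idx (p i)) _ (hs4 (y i).2)).2.2.2 (idx x)
        rw [← ip, ← iq, ← ir] at h
        rcases h with h | h | h | h
        · exact Or.inl (hidx.inj _ _ (hx.trans (fp i).symm) h)
        · exact Or.inr (Or.inl (hidx.inj _ _ hx h))
        · exact Or.inr (Or.inr (Or.inl (hidx.inj _ _ (hx.trans (fq i).symm) h)))
        · exact Or.inr (Or.inr (Or.inr (hidx.inj _ _ (hx.trans (fr i).symm) h)))
      p_ne_d := fun i => ne_of (by rw [ip]; exact (dec _ _ (hs4 (y i).2)).1)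
      p_ne_q := fun i => ne_of (by rw [iq, ip]; exact (dec _ _ (hs4 (y i).2)).2.1)
      p_ne_r := fun i => ne_of (by rw [ir, iq, ip]; exact (dec _ _ (hs4 (y i).2)).2.2.1)
      d_ne_q := fun i => ne_of (by rw [iq]; exact (dec _ _ (hs4 (y i).2)).1)
      d_ne_r := fun i => ne_of (by rw [ir, iq]; exact (dec _ _ (hs4 (y i).2)).2.1)
      q_ne_r := fun i => ne_of (by rw [ir]; exact (dec _ _ (hs4 (y i).2)).1) }
  have hnext : ∀ i, (Z.d i).snd = (Z.d (i + 1)).fst := fun i => by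
    rw [← Z.fst_p, Z.p_succ]
    rfl
  refine ⟨n, hz, Z, fun i => (y i).2, ?_, ?_, hp, fun i => ?_, 0, ?_, ?_⟩
  -- Length 1 would be a loop. Length 2 would run back along the same edge, against `p 1 ≠ d 1`.
  · have h1 : n ≠ 1 := by
      intro h1
      have : (1 : ZMod n) = 0 := by
        have : ((1 : ℕ) : ZMod n) = 0 := (ZMod.natCast_eq_zero_iff 1 n).2 (by rw [h1])
        simpa using this
      have h2 := hnext 0
      rw [this, add_zero] at h2
      exact (Z.d 0).adj.ne h2.symm
    have h2 : n ≠ 2 := by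
      intro h2
      have e : (1 : ZMod n) + 1 = 0 := by
        have : ((2 : ℕ) : ZMod n) = 0 := (ZMod.natCast_eq_zero_iff 2 n).2 (by rw [h2])
        rw [one_add_one_eq_two]
        simpa using this
      have h3 := hnext 1
      rw [e] at h3
      have h4 := hnext 0
      rw [zero_add] at h4
      refine Z.p_ne_d 1 ?_
      have : Z.p 1 = (Z.d 0).symm := by rw [← Z.p_succ, zero_add]
      rw [this]
      ext
      · exact h4
      · exact h3.symm
    omega
  · ext e
    constructor
    · rintro ⟨i, rfl⟩
      exact ⟨y i, ymem i, rfl⟩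
    · rintro ⟨_, ⟨k, rfl⟩, rfl⟩
      exact ⟨(k : ZMod n), by simp only [Z]; rw [ynat]⟩
  · simp only
    rw [ysucc]
    rfl
  · simp [Z, y]
  · simp [y]

variable {X} in
-- A common boundary would contain the edges of `rot⁻¹ d`, `d` and `rot d`, whereas a cycle has only
-- two darts at a vertex.
theorem faceBoundary_ne (hX : X.IsStrong) {idx : G.Dart → ZMod 4} (hidx : X.IsNumbering idx)
    (d : G.Dart) : X.faceBoundary (d, 1) ≠ X.faceBoundary (d, -1) := by
  intro h
  obtain ⟨n, _, Z, t, -, hZ, hd, -, i, hi, hti⟩ := exists_siteCycle hX hidx (d, 1)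
  have hq : dartEdge (X.rot d) ∈ Z.edges := by
    have := X.mem_faceBoundary_prev d (-1)
    rw [← h, ← hZ] at this
    simpa using this
  have hdi := hd i
  rw [hti, hi] at hdi
  simp only [Units.val_one, zpow_one] at hdi
  have hfst : (X.rot d).fst = (Z.d i).fst := by rw [X.fst_rot, hi]
  have hi1 : idx d = idx (Z.p i) + 1 := by rw [hdi, hidx.rot]
  have key : ∀ a : ZMod 4, a + 1 + 1 ≠ a ∧ a + 1 ≠ a := by decide
  refine Z.not_mem_edges hfst (fun e => ?_) (fun e => ?_) hq
  · have := hidx.rot d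
    rw [e, hi1] at this
    exact (key _).1 this.symm
  · have := hidx.rot d
    rw [e, hi] at this
    exact (key _).2 this.symm

end Finite

end EmbeddingScheme

/-! ### Linear algebra over 𝔽₂ of the face boundaries -/

/-- Independent vectors can be given arbitrary images by a linear map to `Additive ℤˣ`. Extended to
all of `E → ZMod 2`, its values on the standard basis are the signs `η`. -/
theorem exists_units_prod_eq {E : Type*} [Fintype E] {Fs : Set (Set E)}
    (h : LinearIndepOn (ZMod 2) (fun γ : Set E => (γ.indicator 1 : E → ZMod 2)) Fs)
    (c : Set E → ℤˣ) : ∃ η : E → ℤˣ, ∀ γ ∈ Fs, ∀ s : Finset E, (s : Set E) = γ →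
      ∏ e ∈ s, η e = c γ := by
  classical
  have hv : LinearIndependent (ZMod 2) fun γ : Fs => ((γ : Set E).indicator 1 : E → ZMod 2) := h
  obtain ⟨g, hg⟩ := LinearMap.exists_extend (V' := Additive ℤˣ)
    ((Finsupp.linearCombination (ZMod 2) fun γ : Fs => Additive.ofMul (c γ)).comp
      hv.repr)
  refine ⟨fun e => (g (Pi.single e 1)).toMul, fun γ hγ s hs => ?_⟩
  have hmem : (γ.indicator 1 : E → ZMod 2) ∈
      Submodule.span (ZMod 2) (Set.range fun γ : Fs => ((γ : Set E).indicator 1 : E → ZMod 2)) :=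
    Submodule.subset_span ⟨⟨γ, hγ⟩, rfl⟩
  have hval : g (γ.indicator 1) = Additive.ofMul (c γ) := by
    have h1 := LinearMap.congr_fun hg ⟨_, hmem⟩
    have h2 := hv.repr_eq_single ⟨γ, hγ⟩ ⟨_, hmem⟩ rfl
    simp only [LinearMap.comp_apply, Submodule.subtype_apply, h2,
      Finsupp.linearCombination_single, one_smul] at h1
    exact h1
  have hsum : (γ.indicator 1 : E → ZMod 2) = ∑ e ∈ s, Pi.single e 1 := by
    ext e
    rw [Finset.sum_apply, Finset.sum_pi_single, Set.indicator_apply]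
    simp [← hs]
  rw [← toMul_sum, ← map_sum, ← hsum, hval, toMul_ofMul]

namespace EmbeddingScheme

variable {V : Type*} {G : SimpleGraph V} {X : EmbeddingScheme G}

theorem eq_of_rot_invariant {α : Type*} (X : EmbeddingScheme G) (f : G.Dart → α)
    (hrot : ∀ d, f (X.rot d) = f d) {d d' : G.Dart} (h : d.fst = d'.fst) : f d = f d' := by
  have hz : ∀ (z : ℤ) d, f ((X.rot ^ z) d) = f d := by
    intro z
    induction z using Int.induction_on with
    | zero => simp
    | succ k ih => intro d; rw [add_comm, zpow_add, zpow_one, Equiv.Perm.mul_apply, hrot, ih]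
    | pred k ih =>
      intro d
      rw [← hrot, ← Equiv.Perm.mul_apply, ← zpow_one_add, add_sub_cancel, ih]
  obtain ⟨z, hz'⟩ := X.sameCycle_rot d d' h
  rw [← hz', hz]

theorem eq_of_invariant {α : Type*} (hconn : G.Connected) (X : EmbeddingScheme G) (f : G.Dart → α)
    (hrot : ∀ d, f (X.rot d) = f d) (hsymm : ∀ d, f d.symm = f d) (d d' : G.Dart) :
    f d = f d' := by
  have hw : ∀ {u v : V} (_ : G.Walk u v) (d d' : G.Dart), d.fst = u → d'.fst = v → f d = f d' := by
    intro u v w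
    induction w with
    | nil => exact fun d d' h h' => X.eq_of_rot_invariant f hrot (h.trans h'.symm)
    | cons hadj w ih =>
      intro d d' h h'
      let e : G.Dart := ⟨(_, _), hadj⟩
      rw [X.eq_of_rot_invariant f hrot (d' := e) h, ← hsymm e]
      exact ih _ _ rfl h'
  obtain ⟨w⟩ := hconn.preconnected d.fst d'.fst
  exact hw w d d' rfl rfl

/-- A maximal free family of face boundaries omits at most one face boundary. -/
theorem mem_or_mem_of_isMaximalFree [Finite V] (hconn : G.Connected) (hX : X.IsStrong)
    {idx : G.Dart → ZMod 4} (hidx : X.IsNumbering idx) {Fs : Set (Set G.edgeSet)}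
    (hFs : IsMaximalFree X.faceBoundaries Fs) {F₁ F₂ : Set G.edgeSet}
    (h₁ : F₁ ∈ X.faceBoundaries) (h₂ : F₂ ∈ X.faceBoundaries) (hne : F₁ ≠ F₂) :
    F₁ ∈ Fs ∨ F₂ ∈ Fs := by
  classical
  by_contra hcon
  push Not at hcon
  obtain ⟨hn₁, hn₂⟩ := hcon
  have := Fintype.ofFinite (Set G.edgeSet)
  have hspan : (F₁.indicator 1 : G.edgeSet → ZMod 2) ∈
      Submodule.span (ZMod 2) ((fun γ : Set G.edgeSet => (γ.indicator 1 : G.edgeSet → ZMod 2)) '' Fs) := by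
    by_contra hs
    refine hn₁ (hFs.le_of_ge (y := insert F₁ Fs) ⟨?_, ?_⟩ (Set.subset_insert _ _)
      (Set.mem_insert _ _))
    · exact Set.insert_subset h₁ hFs.prop.1
    · exact (linearIndepOn_insert hn₁).2 ⟨hFs.prop.2, hs⟩
  obtain ⟨l, hl, hsum⟩ := Finsupp.mem_span_image_iff_linearCombination _ |>.1 hspan
  have hl' : ∀ F, F ∉ Fs → l F = 0 := fun F hF => by
    by_contra h0
    exact hF (hl (Finsupp.mem_support_iff.2 h0))
  -- The coefficients of a linear relation: the expansion of `F₁` in `Fs`, minus `F₁` itself.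
  let m : Set G.edgeSet → ZMod 2 := fun F => l F - if F = F₁ then 1 else 0
  have hm : ∀ F, F ∉ X.faceBoundaries → m F = 0 := fun F hF => by
    have h1 : F ≠ F₁ := fun h => hF (h ▸ h₁)
    simp [m, h1, hl' F fun h => hF (hFs.prop.1 h)]
  have hm0 : ∀ e, ∑ F, m F * F.indicator 1 e = 0 := fun e => by
    have h := congrFun hsum e
    rw [Finsupp.linearCombination_apply, Finsupp.sum_fintype _ _ (by simp), Finset.sum_apply] at h
    simp only [Pi.smul_apply, smul_eq_mul] at h
    simp only [m, sub_mul, Finset.sum_sub_distrib, h, ite_mul, one_mul, zero_mul,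
      Finset.sum_ite_eq', Finset.mem_univ, if_true, sub_self]
  -- Only the two faces at its sides contain a given edge, so the relation read at that edge equates
  -- their coefficients. Connectedness then makes `m` constant on the faces.
  have hside : ∀ d, m (X.faceBoundary (d, 1)) = m (X.faceBoundary (d, -1)) := fun d => by
    have h := hm0 (dartEdge d)
    rw [Fintype.sum_eq_add _ _ (faceBoundary_ne hX hidx d)] at h
    · have hi : ∀ s, (X.faceBoundary (d, s)).indicator (1 : G.edgeSet → ZMod 2) (dartEdge d) = 1 :=
        fun s => Set.indicator_of_mem (X.mem_faceBoundary_self (d, s)) _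
      rw [hi, hi, mul_one, mul_one] at h
      exact CharTwo.add_eq_zero.1 h
    · rintro F ⟨hF1, hF2⟩
      by_cases hF : F ∈ X.faceBoundaries
      · obtain ⟨x, rfl⟩ := hF
        have : dartEdge d ∉ X.faceBoundary x := fun h =>
          (X.faceBoundary_eq_of_mem d h).elim hF1 hF2
        rw [Set.indicator_of_notMem this, mul_zero]
      · rw [hm F hF, zero_mul]
  let f : G.Dart → ZMod 2 := fun d => m (X.faceBoundary (d, 1))
  have hf : ∀ d x, dartEdge d ∈ X.faceBoundary x → m (X.faceBoundary x) = f d := fun d x h => by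
    rcases X.faceBoundary_eq_of_mem d h with h | h
    · rw [h]
    · rw [h, ← hside]
  have hconst := eq_of_invariant hconn X f
    (fun d => (hf (X.rot d) (X.rot d, 1) (X.mem_faceBoundary_self _)).symm.trans
      (hf d _ (by simpa using X.mem_faceBoundary_prev (X.rot d) 1)))
    (fun d => (hf d.symm (d.symm, 1) (X.mem_faceBoundary_self _)).symm.trans
      (hf d _ (by simpa [dartEdge_symm] using X.mem_faceBoundary_self (d.symm, 1))))
  obtain ⟨x₁, rfl⟩ := h₁
  obtain ⟨x₂, rfl⟩ := h₂
  -- Constancy is absurd: `m` is `-1` at `F₁` and `0` at `F₂`.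
  have e := (hf _ _ (X.mem_faceBoundary_self x₁)).trans
    ((hconst _ _).trans (hf _ _ (X.mem_faceBoundary_self x₂)).symm)
  simp [m, hl' _ hn₁, hl' _ hn₂, hne.symm] at e

end EmbeddingScheme

/-! ### Normalized weights solve the cycle equations -/

namespace SiteCycle

variable {V : Type*} {G : SimpleGraph V} {n : ℕ}

/-- The cyclic ordering of the edges of the walk. -/
def cyclicOrdering (Z : SiteCycle G n) (hn : 3 ≤ n) : CyclicOrdering G Z.edges where
  len := n
  three_le := hn
  dart := Z.d
  snd_eq i := by
    rw [← Z.fst_p, Z.p_succ]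
    rfl
  inj := Z.inj
  edges := rfl

theorem exists_even_perm : ∀ j k : Fin 4, j ≠ k →
    ∃ σ : Equiv.Perm (Fin 4), Equiv.Perm.sign σ = 1 ∧ σ 0 = j ∧ σ 3 = k := by
  decide

/-- The quotients `U T̄ / S` and `U T / S̄` are `t` and `-t`, which turns the equation for `B ^ 2`
into `edge_sq`. Which lateral dart the even permutation puts second is irrelevant, as the triangle
equations are symmetric. -/
theorem Flat.solvesCycleEquations [NeZero n] {Z : SiteCycle G n} (hn : 3 ≤ n) (ord : SiteOrder G)
    {A : Matrix G.Dart G.Dart ℂ} {t : ZMod n → ℂ} (hA : Z.Flat A t) :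
    SolvesCycleEquations ord A Z.edges := by
  have hplace : ∀ i : ZMod n, ∃ σ : Equiv.Perm (Fin 4), Equiv.Perm.sign σ = 1 ∧
      (ord (Z.d i).fst (σ 0) : G.Dart) = Z.p i ∧ (ord (Z.d i).fst (σ 3) : G.Dart) = Z.d i := by
    intro i
    obtain ⟨j, hj⟩ := (ord (Z.d i).fst).surjective ⟨Z.p i, Z.fst_p i⟩
    obtain ⟨k, hk⟩ := (ord (Z.d i).fst).surjective ⟨Z.d i, rfl⟩
    have hjk : j ≠ k := by
      rintro rfl
      exact Z.p_ne_d i (Subtype.ext_iff.1 (hj.symm.trans hk))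
    obtain ⟨σ, h1, h2, h3⟩ := exists_even_perm j k hjk
    exact ⟨σ, h1, by rw [h2, hj], by rw [h3, hk]⟩
  choose σ hσ using hplace
  have hlat : ∀ i : ZMod n,
      ((ord (Z.d i).fst (σ i 1) : G.Dart) = Z.q i ∧ (ord (Z.d i).fst (σ i 2) : G.Dart) = Z.r i) ∨
      ((ord (Z.d i).fst (σ i 1) : G.Dart) = Z.r i ∧
        (ord (Z.d i).fst (σ i 2) : G.Dart) = Z.q i) := by
    intro i
    obtain ⟨-, h0, h3⟩ := hσ i
    have hinj : ∀ j k : Fin 4, j ≠ k →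
        (ord (Z.d i).fst (σ i j) : G.Dart) ≠ ord (Z.d i).fst (σ i k) := fun j k hjk h =>
      hjk ((σ i).injective (ord_inj ord h).2)
    have h10 := hinj 1 0 (by decide)
    have h13 := hinj 1 3 (by decide)
    have h20 := hinj 2 0 (by decide)
    have h23 := hinj 2 3 (by decide)
    have h12 := hinj 1 2 (by decide)
    rw [h0] at h10 h20
    rw [h3] at h13 h23
    have c1 := ((Z.cover i _ (ord_fst ord _ (σ i 1))).resolve_left h10).resolve_left h13
    have c2 := ((Z.cover i _ (ord_fst ord _ (σ i 2))).resolve_left h20).resolve_left h23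
    rcases c1 with c1 | c1 <;> rcases c2 with c2 | c2
    · exact absurd (c1.trans c2.symm) h12
    · exact Or.inl ⟨c1, c2⟩
    · exact Or.inr ⟨c1, c2⟩
    · exact absurd (c1.trans c2.symm) h12
  -- the places 1 and 2 carry the lateral darts
  have hsite : ∀ i : ZMod n, ∃ x y : G.Dart,
      (ord (Z.d i).fst (σ i 1) : G.Dart) = x ∧ (ord (Z.d i).fst (σ i 2) : G.Dart) = y ∧
      A (Z.p i) x * A (Z.p i) x = 1 ∧ A (Z.p i) y * A (Z.p i) y = 1 ∧
      A (Z.d i) x * A (Z.d i) x = 1 ∧ A (Z.d i) y * A (Z.d i) y = 1 ∧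
      A (Z.p i) (Z.d i) * A (Z.d i) x * A (Z.p i) x = t i ∧
      A (Z.p i) (Z.d i) * A (Z.d i) y * A (Z.p i) y = t i := by
    intro i
    have hpq := hA.sq _ _ ((Z.fst_p i).trans (Z.fst_q i).symm) (Z.p_ne_q i)
    have hpr := hA.sq _ _ ((Z.fst_p i).trans (Z.fst_r i).symm) (Z.p_ne_r i)
    have hdq := hA.sq _ _ (Z.fst_q i).symm (Z.d_ne_q i)
    have hdr := hA.sq _ _ (Z.fst_r i).symm (Z.d_ne_r i)
    rcases hlat i with ⟨h1, h2⟩ | ⟨h1, h2⟩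
    · exact ⟨_, _, h1, h2, hpq, hpr, hdq, hdr, hA.tri_q i, hA.tri_r i⟩
    · exact ⟨_, _, h1, h2, hpr, hpq, hdr, hdq, hA.tri_r i, hA.tri_q i⟩
  have hUT : ∀ i : ZMod n, siteU ord A (Z.d i).fst (σ i) * siteTbar ord A (Z.d i).fst (σ i) /
      siteS ord A (Z.d i).fst (σ i) = t i ∧
      siteU ord A (Z.d i).fst (σ i) * siteT ord A (Z.d i).fst (σ i) /
      siteSbar ord A (Z.d i).fst (σ i) = -t i ∧
      siteS ord A (Z.d i).fst (σ i) * siteSbar ord A (Z.d i).fst (σ i) +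
      siteT ord A (Z.d i).fst (σ i) * siteTbar ord A (Z.d i).fst (σ i) = 0 := by
    intro i
    obtain ⟨x, y, hx, hy, px, py, dx, dy, tx, ty⟩ := hsite i
    have hU := hA.sq _ _ (Z.fst_p i) (Z.p_ne_d i)
    simp only [siteU, siteS, siteSbar, siteT, siteTbar, siteEntry, (hσ i).2.1, (hσ i).2.2, hx, hy]
    have px0 : A (Z.p i) x ≠ 0 := left_ne_zero_of_mul_eq_one px
    have dy0 : A (Z.d i) y ≠ 0 := left_ne_zero_of_mul_eq_one dy
    rw [hA.antisymm (Z.d i) y]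
    refine ⟨?_, ?_, ?_⟩
    · rw [div_eq_iff px0, ← tx]
      linear_combination -(A (Z.p i) (Z.d i) * A (Z.d i) x) * px
    · rw [div_eq_iff (neg_ne_zero.2 dy0), ← ty]
      linear_combination -(A (Z.p i) (Z.d i) * A (Z.p i) y) * dy
    · have h := tx.trans ty.symm
      linear_combination (A (Z.p i) (Z.d i) * A (Z.p i) x * A (Z.p i) y) * h +
        (-A (Z.p i) y * A (Z.d i) x + A (Z.p i) x * A (Z.d i) y) * hU +
        (-A (Z.p i) (Z.d i) * A (Z.p i) (Z.d i) * A (Z.p i) y * A (Z.d i) x) * px +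
        (A (Z.p i) (Z.d i) * A (Z.p i) (Z.d i) * A (Z.p i) x * A (Z.d i) y) * py
  refine ⟨Z.cyclicOrdering hn, σ, fun i : ZMod n => ⟨(hσ i).1, ?_, (hσ i).2.2⟩,
    fun i : ZMod n => ?_, fun (i : ZMod n) d d' hd hd' hne => ?_, fun i => (hUT i).2.2,
    fun i : ZMod n => ?_, ?_⟩
  · exact (hσ i).2.1.trans (Z.p_eq i)
  · intro h0
    have h1 := hA.edge_sq i
    have h2 := hA.t_sq i
    have h3 := hA.t_sq (i + 1)
    have h0' : A (Z.d i) (Z.d i).symm = 0 := h0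
    rw [h0', mul_zero] at h1
    have : t i * t (i + 1) * (t i * t (i + 1)) = 1 := by
      linear_combination t (i + 1) * t (i + 1) * h2 + h3
    rw [← h1] at this
    simp at this
  · exact left_ne_zero_of_mul_eq_one (hA.sq d d' (hd.trans hd'.symm) hne)
  · refine Eq.trans (b := -(t i * -t (i + 1))) ?_ ?_
    · change A (Z.d i) (Z.d i).symm ^ 2 = _
      linear_combination hA.edge_sq i
    · rw [← (hUT i).1, ← (hUT (i + 1)).2.1]
      rfl
  · refine Eq.trans (b := ∏ i, A (Z.d i) (Z.d i).symm) rfl (hA.prod.trans ?_)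
    refine congrArg Neg.neg (Finset.prod_congr rfl fun i _ => ?_)
    change _ = siteEntry ord A (Z.d i).fst (σ i) 0 3
    rw [siteEntry, (hσ i).2.1, (hσ i).2.2]

end SiteCycle

/-! ### The incidence matrix of an embedding scheme -/

/-- The sign of the position of `j` relative to `i` among `0, 1, 2, 3`. -/
def cycSign (i j : ZMod 4) : ℤ := if i = j then 0 else if i.val < j.val then 1 else -1

theorem cycSign_swap : ∀ i j, cycSign j i = -cycSign i j := by decide

theorem cycSign_mul_self : ∀ i j, i ≠ j → cycSign i j * cycSign i j = 1 := by decide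

/-- The product of the three order signs of a triple depends only on its cyclic order, and `i`, `i +
1`, `x` is cyclically increasing even across the jump from 3 to 0. -/
theorem cycSign_triple_one : ∀ i x : ZMod 4, x ≠ i → x ≠ i + 1 →
    cycSign i (i + 1) * cycSign (i + 1) x * cycSign i x = 1 := by decide

theorem cycSign_triple_neg_one : ∀ i x : ZMod 4, x ≠ i → x ≠ i + -1 →
    cycSign i (i + -1) * cycSign (i + -1) x * cycSign i x = -1 := by decide

theorem unit_mul_self_cast (u : ℤˣ) : (((u : ℤ) : ℂ)) * ((u : ℤ) : ℂ) = 1 := by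
  rcases Int.units_eq_one_or u with rfl | rfl <;> simp

namespace EmbeddingScheme

variable {V : Type*} {G : SimpleGraph V}

/-- The signature of the edge of `d` after reversal of the rotation at the vertices with `ε = -1`. -/
def twist (X : EmbeddingScheme G) (ε : V → ℤˣ) (d : G.Dart) : ℤˣ :=
  ε d.fst * X.sgn (dartEdge d) * ε d.snd

theorem twist_symm (X : EmbeddingScheme G) (ε : V → ℤˣ) (d : G.Dart) :
    X.twist ε d.symm = X.twist ε d := by
  simp only [twist, dartEdge_symm]
  rw [mul_assoc, mul_comm, mul_comm (X.sgn _)]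
  rfl

/-- `t i * ε` is the turning sense relative to the reversed rotation; the twisted signature records
its change along an edge. -/
theorem twist_eq {X : EmbeddingScheme G} {ε : V → ℤˣ} {n : ℕ} {Z : SiteCycle G n} {t : ZMod n → ℤˣ}
    (ht : ∀ i, t (i + 1) = t i * X.sgn (dartEdge (Z.d i))) (i : ZMod n) :
    t i * ε (Z.d i).fst * (t (i + 1) * ε (Z.d (i + 1)).fst) = X.twist ε (Z.d i) := by
  have hnext : (Z.d (i + 1)).fst = (Z.d i).snd := by
    rw [← Z.fst_p, Z.p_succ]
    rfl
  rw [ht, hnext, twist]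
  calc _ = t i * t i * (ε (Z.d i).fst * X.sgn (dartEdge (Z.d i)) * ε (Z.d i).snd) := by ac_rfl
    _ = _ := by rw [Int.units_mul_self, one_mul]

/-- The incidence matrix with site entries given by the order of the darts along the rotation and
edge entries given by the signature, up to signs `η` of the edges. -/
noncomputable def incidence [DecidableEq V] (X : EmbeddingScheme G) (idx : G.Dart → ZMod 4)
    (ε : V → ℤˣ) (o : G.Dart → ℤˣ) (η : G.edgeSet → ℤˣ) : Matrix G.Dart G.Dart ℂ := fun d d' =>
  if d' = d.symm then
    ((η (dartEdge d) : ℤ) : ℂ) * ((o d : ℤ) : ℂ) * if X.twist ε d = 1 then 1 else Complex.I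
  else if d.fst = d'.fst then ((ε d.fst : ℤ) : ℂ) * (cycSign (idx d) (idx d') : ℂ) else 0

section Incidence

variable [DecidableEq V] {X : EmbeddingScheme G} {idx : G.Dart → ZMod 4} {ε : V → ℤˣ}
  {o : G.Dart → ℤˣ} {η : G.edgeSet → ℤˣ}

theorem incidence_symm (d : G.Dart) : X.incidence idx ε o η d d.symm =
    ((η (dartEdge d) : ℤ) : ℂ) * ((o d : ℤ) : ℂ) * if X.twist ε d = 1 then 1 else Complex.I :=
  if_pos rfl

theorem incidence_site {d d' : G.Dart} (h : d.fst = d'.fst) : X.incidence idx ε o η d d' =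
    ((ε d.fst : ℤ) : ℂ) * (cycSign (idx d) (idx d') : ℂ) := by
  rw [incidence, if_neg, if_pos h]
  rintro rfl
  exact fst_symm_ne d h.symm

theorem incidence_swap (ho : ∀ d, o d.symm = -o d) (d d' : G.Dart) :
    X.incidence idx ε o η d' d = -X.incidence idx ε o η d d' := by
  by_cases h : d' = d.symm
  · subst h
    have := incidence_symm (X := X) (idx := idx) (ε := ε) (o := o) (η := η) d.symm
    rw [SimpleGraph.Dart.symm_symm, twist_symm, dartEdge_symm, ho] at this
    rw [this, incidence_symm]
    push_cast
    ring
  · by_cases h' : d.fst = d'.fst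
    · rw [incidence_site h', incidence_site h'.symm, cycSign_swap, h']
      push_cast
      ring
    · have h2 : ¬d = d'.symm := by
        rintro rfl
        exact h (SimpleGraph.Dart.symm_symm _).symm
      rw [incidence, incidence, if_neg h, if_neg h2, if_neg h', if_neg (Ne.symm h'), neg_zero]

theorem isIncidenceMatrix_incidence (ho : ∀ d, o d.symm = -o d) :
    IsIncidenceMatrix G (X.incidence idx ε o η) := by
  refine ⟨?_, fun d d' h => ?_⟩
  · ext d d'
    exact incidence_swap ho d d'
  · by_cases h1 : d' = d.symm
    · subst h1
      exact absurd ⟨fun h => fst_symm_ne d (by rw [← h]), Or.inr d.edge_symm.symm⟩ h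
    · by_cases h2 : d.fst = d'.fst
      · have : d = d' := by
          by_contra hne
          exact h ⟨hne, Or.inl h2⟩
        subst this
        rw [incidence_site rfl]
        simp [cycSign]
      · rw [incidence, if_neg h1, if_neg h2]

theorem incidence_reality (d d' : G.Dart) :
    if d.edge = d'.edge ∧ X.twist ε d = -1 then (X.incidence idx ε o η d d').re = 0
    else (X.incidence idx ε o η d d').im = 0 := by
  by_cases h1 : d' = d.symm
  · subst h1
    rw [incidence_symm]
    rcases Int.units_eq_one_or (X.twist ε d) with h | h <;> simp [h]
  · have hre : ∀ z : ℤ, ∀ u : ℤˣ, (((u : ℤ) : ℂ) * (z : ℂ)).im = 0 := fun z u => by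
      rw [← Int.cast_mul]
      exact Complex.intCast_im _
    have him : (X.incidence idx ε o η d d').im = 0 := by
      rw [incidence, if_neg h1]
      split_ifs
      · exact hre _ _
      · simp
    split_ifs with h
    · have : d = d' := by
        rcases (SimpleGraph.dart_edge_eq_iff d d').1 h.1 with h | h
        · exact h
        · exact absurd (by rw [h, SimpleGraph.Dart.symm_symm]) h1
      subst this
      rw [incidence_site rfl]
      simp [cycSign]
    · exact him

theorem incidence_mul_self (d : G.Dart) : X.incidence idx ε o η d d.symm *
    X.incidence idx ε o η d d.symm = ((X.twist ε d : ℤ) : ℂ) := by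
  rw [incidence_symm]
  have h1 := unit_mul_self_cast (η (dartEdge d))
  have h2 := unit_mul_self_cast (o d)
  have h3 : (if X.twist ε d = 1 then (1 : ℂ) else Complex.I) *
      (if X.twist ε d = 1 then (1 : ℂ) else Complex.I) = ((X.twist ε d : ℤ) : ℂ) := by
    rcases Int.units_eq_one_or (X.twist ε d) with h | h <;> simp [h]
  rw [← h3]
  set κ : ℂ := if X.twist ε d = 1 then (1 : ℂ) else Complex.I
  linear_combination κ * κ * ((o d : ℤ) : ℂ) * ((o d : ℤ) : ℂ) * h1 + κ * κ * h2

/-- A triangle contains `ε` three times, hence once, and the order signs contribute the turning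
sense. Of the equations, only the product one depends on `η`. -/
theorem flat_incidence {n : ℕ} [NeZero n] (hidx : X.IsNumbering idx)
    (ho : ∀ d, o d.symm = -o d) {Z : SiteCycle G n} {t : ZMod n → ℤˣ}
    (hd : ∀ i, Z.d i = (X.rot ^ (t i : ℤ)) (Z.p i))
    (ht : ∀ i, t (i + 1) = t i * X.sgn (dartEdge (Z.d i)))
    (hprod : ∏ i, X.incidence idx ε o η (Z.d i) (Z.d i).symm =
      -∏ i, X.incidence idx ε o η (Z.p i) (Z.d i)) :
    Z.Flat (X.incidence idx ε o η) fun i => (((t i * ε (Z.d i).fst : ℤˣ) : ℤ) : ℂ) := by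
  have htri : ∀ i x, x.fst = (Z.d i).fst → Z.p i ≠ x → Z.d i ≠ x →
      X.incidence idx ε o η (Z.p i) (Z.d i) * X.incidence idx ε o η (Z.d i) x *
        X.incidence idx ε o η (Z.p i) x = (((t i * ε (Z.d i).fst : ℤˣ) : ℤ) : ℂ) := by
    intro i x hx hpx hdx
    have h1 : idx x ≠ idx (Z.p i) := fun h => hpx (hidx.inj _ _ (hx.trans (Z.fst_p i).symm) h).symm
    have h2 : idx x ≠ idx (Z.d i) := fun h => hdx (hidx.inj _ _ hx h).symm
    have hdi : idx (Z.d i) = idx (Z.p i) + ((t i : ℤ) : ZMod 4) := by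
      conv_lhs => rw [hd i]
      exact hidx.zpow _ _
    rw [incidence_site (Z.fst_p i), incidence_site hx.symm,
      incidence_site ((Z.fst_p i).trans hx.symm), Z.fst_p i]
    have hc : cycSign (idx (Z.p i)) (idx (Z.d i)) * cycSign (idx (Z.d i)) (idx x) *
        cycSign (idx (Z.p i)) (idx x) = t i := by
      rw [hdi] at h2 ⊢
      rcases Int.units_eq_one_or (t i) with h | h
      · rw [h] at h2 ⊢
        simp only [Units.val_one, Int.cast_one] at h2 ⊢
        exact cycSign_triple_one _ _ h1 h2
      · rw [h] at h2 ⊢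
        simp only [Units.val_neg, Units.val_one, Int.cast_neg, Int.cast_one] at h2 ⊢
        exact cycSign_triple_neg_one _ _ h1 h2
    have hc' := congrArg (Int.cast : ℤ → ℂ) hc
    push_cast at hc' ⊢
    rw [← hc']
    linear_combination ((ε (Z.d i).fst : ℤ) : ℂ) * (cycSign (idx (Z.p i)) (idx (Z.d i)) : ℂ) *
      (cycSign (idx (Z.d i)) (idx x) : ℂ) * (cycSign (idx (Z.p i)) (idx x) : ℂ) *
      unit_mul_self_cast (ε (Z.d i).fst)
  refine ⟨incidence_swap ho, fun a b h hne => ?_, fun i => unit_mul_self_cast _,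
    fun i => htri i _ (Z.fst_q i) (Z.p_ne_q i) (Z.d_ne_q i),
    fun i => htri i _ (Z.fst_r i) (Z.p_ne_r i) (Z.d_ne_r i), fun i => ?_, hprod⟩
  · have h1 : idx a ≠ idx b := fun e => hne (hidx.inj a b h e)
    have h2 := congrArg (Int.cast : ℤ → ℂ) (cycSign_mul_self _ _ h1)
    push_cast at h2
    rw [incidence_site h]
    linear_combination (cycSign (idx a) (idx b) : ℂ) * (cycSign (idx a) (idx b) : ℂ) *
      unit_mul_self_cast (ε a.fst) + h2
  · rw [incidence_mul_self, ← twist_eq ht]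
    push_cast
    ring

end Incidence

theorem exists_orientation (G : SimpleGraph V) : ∃ o : G.Dart → ℤˣ, ∀ d, o d.symm = -o d := by
  classical
  let r : V → V → Prop := WellOrderingRel
  refine ⟨fun d => if r d.fst d.snd then 1 else -1, fun d => ?_⟩
  change (if r d.snd d.fst then (1 : ℤˣ) else -1) = -if r d.fst d.snd then 1 else -1
  rcases trichotomous_of r d.fst d.snd with h | h | h
  · rw [if_pos h, if_neg (asymm_of r h)]
  · exact absurd h d.adj.ne
  · rw [if_pos h, if_neg (asymm_of r h), neg_neg]

/-- Keeping `ε` free serves both parts: `ε = 1` leaves the signature as it is, and an `ε` that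
trivializes the twisted signature makes every entry real. -/
theorem exists_incidenceMatrix [Fintype V] [DecidableEq V] [DecidableRel G.Adj]
    (hreg : G.IsRegularOfDegree 4) {X : EmbeddingScheme G} (hX : X.IsStrong) (ord : SiteOrder G)
    (ε : V → ℤˣ) {Fs : Set (Set G.edgeSet)} (hsub : Fs ⊆ X.faceBoundaries)
    (hfree : LinearIndepOn (ZMod 2)
      (fun γ : Set G.edgeSet => (γ.indicator 1 : G.edgeSet → ZMod 2)) Fs) :
    ∃ A : Matrix G.Dart G.Dart ℂ, IsIncidenceMatrix G A ∧
      (∀ d d' : G.Dart, if d.edge = d'.edge ∧ X.twist ε d = -1 then (A d d').re = 0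
        else (A d d').im = 0) ∧
      (∀ γ ∈ Fs, SolvesCycleEquations ord A γ) ∧
      ∀ C, IsClosedCurve G C → ∀ γ ∈ Fs,
        curveWeight ord A (refMatching ord) C =
          curveWeight ord A (refMatching ord) (symmDiff C γ) := by
  classical
  obtain ⟨idx, hidx⟩ := X.exists_numbering hreg
  obtain ⟨o, ho⟩ := exists_orientation G
  -- For each face, `c` is the product of edge signs which the product equation requires; it is
  -- found before `η` is chosen.
  have hface : ∀ γ : Set G.edgeSet, ∃ c : ℤˣ, γ ∈ Fs → ∃ (n : ℕ) (_ : NeZero n)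
      (Z : SiteCycle G n), 3 ≤ n ∧ Z.edges = γ ∧ ∀ η : G.edgeSet → ℤˣ,
        (∀ s : Finset G.edgeSet, (s : Set G.edgeSet) = γ → ∏ e ∈ s, η e = c) →
        ∃ t : ZMod n → ℂ, Z.Flat (X.incidence idx ε o η) t := by
    intro γ
    by_cases hγ : γ ∈ Fs
    swap
    · exact ⟨1, fun h => absurd h hγ⟩
    obtain ⟨x, rfl⟩ := hsub hγ
    obtain ⟨n, hn, Z, t, h3, hZ, hd, ht, -⟩ := exists_siteCycle hX hidx x
    let P : ℂ := ∏ i, X.incidence idx ε o 1 (Z.d i) (Z.d i).symm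
    let Q : ℂ := ∏ i, X.incidence idx ε o 1 (Z.p i) (Z.d i)
    let τ : ZMod n → ℂ := fun i => (((t i * ε (Z.d i).fst : ℤˣ) : ℤ) : ℂ)
    have hsite : ∀ (η : G.edgeSet → ℤˣ) i, X.incidence idx ε o η (Z.p i) (Z.d i) =
        X.incidence idx ε o 1 (Z.p i) (Z.d i) := fun η i => by
      rw [incidence_site (Z.fst_p i), incidence_site (Z.fst_p i)]
    have hedge : ∀ (η : G.edgeSet → ℤˣ) i, X.incidence idx ε o η (Z.d i) (Z.d i).symm =
        ((η (dartEdge (Z.d i)) : ℤ) : ℂ) * X.incidence idx ε o 1 (Z.d i) (Z.d i).symm :=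
      fun η i => by
      rw [incidence_symm, incidence_symm]
      simp [mul_assoc]
    have hQ : Q * Q = 1 := by
      rw [← Finset.prod_mul_distrib]
      refine Finset.prod_eq_one fun i _ => ?_
      have h1 : idx (Z.p i) ≠ idx (Z.d i) := fun e => Z.p_ne_d i (hidx.inj _ _ (Z.fst_p i) e)
      have h2 := congrArg (Int.cast : ℤ → ℂ) (cycSign_mul_self _ _ h1)
      push_cast at h2
      rw [incidence_site (Z.fst_p i)]
      linear_combination (cycSign (idx (Z.p i)) (idx (Z.d i)) : ℂ) *
        (cycSign (idx (Z.p i)) (idx (Z.d i)) : ℂ) * unit_mul_self_cast (ε (Z.p i).fst) + h2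
    -- The square of each edge entry is `τ i * τ (i + 1)`, and every `τ i` occurs twice around the
    -- face.
    have hP : P * P = 1 := by
      have h1 : P * P = ∏ i, τ i * τ (i + 1) := by
        rw [← Finset.prod_mul_distrib]
        refine Finset.prod_congr rfl fun i _ => ?_
        rw [incidence_mul_self, ← twist_eq ht]
        simp only [τ]
        push_cast
        ring
      rw [h1, Finset.prod_mul_distrib,
        show ∏ i, τ (i + 1) = ∏ i, τ i from Equiv.prod_comp (Equiv.addRight (1 : ZMod n)) τ,
        ← Finset.prod_mul_distrib]
      exact Finset.prod_eq_one fun i _ => unit_mul_self_cast _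
    -- The requirement is `c * P = -Q`, and `P * P = 1`.
    obtain ⟨c, hc⟩ : ∃ c : ℤˣ, ((c : ℤ) : ℂ) = -(Q * P) := by
      rcases mul_self_eq_one_iff.1 (show Q * P * (Q * P) = 1 by
        linear_combination P * P * hQ + hP) with h | h
      · exact ⟨-1, by simp [h]⟩
      · exact ⟨1, by simp [h]⟩
    have hinj : Function.Injective fun i => dartEdge (Z.d i) := fun i j h => by
      rcases dartEdge_eq_iff.1 h with h | h
      · exact Z.d_inj h
      · rw [← Z.p_succ] at h
        exact absurd h.symm (Z.p_ne_d' _ _)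
    refine ⟨c, fun _ => ⟨n, hn, Z, h3, hZ, fun η hη => ⟨τ, flat_incidence hidx ho hd ht ?_⟩⟩⟩
    have h1 := hη (Finset.univ.image fun i => dartEdge (Z.d i)) (by
      rw [Finset.coe_image, Finset.coe_univ, Set.image_univ]
      exact hZ)
    rw [Finset.prod_image hinj.injOn] at h1
    have h2 : ∏ i, ((η (dartEdge (Z.d i)) : ℤ) : ℂ) = ((c : ℤ) : ℂ) := by
      rw [← h1]
      push_cast
      rfl
    simp only [hsite η, hedge η]
    rw [Finset.prod_mul_distrib, h2, hc]
    change -(Q * P) * P = -Q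
    linear_combination -Q * hP
  choose c hc using hface
  obtain ⟨η, hη⟩ := exists_units_prod_eq hfree c
  refine ⟨X.incidence idx ε o η, isIncidenceMatrix_incidence ho, incidence_reality,
    fun γ hγ => ?_, fun C hC γ hγ => ?_⟩
  · obtain ⟨n, hn, Z, h3, rfl, hZ⟩ := hc γ hγ
    obtain ⟨t, hA⟩ := hZ η fun s hs => hη _ hγ s hs
    exact hA.solvesCycleEquations h3 ord
  · obtain ⟨n, hn, Z, h3, rfl, hZ⟩ := hc γ hγ
    obtain ⟨t, hA⟩ := hZ η fun s hs => hη _ hγ s hs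
    exact Z.curveWeight_symmDiff_of_isClosedCurve ord hA hC

end EmbeddingScheme

/-! ### The cycle equations freed from the choice of ordering -/

section CycleEquations

variable {V : Type*} {G : SimpleGraph V} {ord : SiteOrder G} {A : Matrix G.Dart G.Dart ℂ}
  {γ : Set G.edgeSet}

theorem CyclicOrdering.eq_or_eq (c : CyclicOrdering G γ) {i : ZMod c.len} {u : G.Dart}
    (hu : dartEdge u ∈ γ) (h : u.fst = (c.dart i).fst) :
    u = c.dart i ∨ u = (c.dart (i - 1)).symm := by
  rw [← c.edges] at hu
  obtain ⟨j, hj⟩ := hu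
  rcases dartEdge_eq_iff.1 hj.symm with e | e
  · left
    rw [e, c.inj (show (c.dart j).fst = (c.dart i).fst by rw [← h, e])]
  · right
    have : j + 1 = i := c.inj (show (c.dart (j + 1)).fst = (c.dart i).fst by
      rw [← h, e, ← c.snd_eq]; rfl)
    rw [e, ← this, add_sub_cancel_right]

theorem CyclicOrdering.exists_fst_eq (c : CyclicOrdering G γ) {u : G.Dart}
    (hu : dartEdge u ∈ γ) : ∃ i, u.fst = (c.dart i).fst := by
  rw [← c.edges] at hu
  obtain ⟨j, hj⟩ := hu
  rcases dartEdge_eq_iff.1 hj.symm with e | e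
  · exact ⟨j, by rw [e]⟩
  · exact ⟨j + 1, by rw [e, ← c.snd_eq]; rfl⟩

theorem eq_or_eq_of_site (ord : SiteOrder G) {v : V} (σ : Equiv.Perm (Fin 4)) {y : G.Dart}
    (hy : y.fst = v) (h0 : y ≠ ord v (σ 0)) (h3 : y ≠ ord v (σ 3)) :
    y = ord v (σ 1) ∨ y = ord v (σ 2) := by
  obtain ⟨j, hj⟩ := (ord v).surjective ⟨y, hy⟩
  obtain ⟨k, rfl⟩ := σ.surjective j
  have hj' : y = ord v (σ k) := by rw [hj]
  fin_cases k
  exacts [absurd hj' h0, Or.inl hj', Or.inr hj', absurd hj' h3]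

theorem SolvesCycleEquations.ne_zero (h : SolvesCycleEquations ord A γ) {u d d' : G.Dart}
    (hu : dartEdge u ∈ γ) (hd : d.fst = u.fst) (hd' : d'.fst = u.fst) (hne : d ≠ d') :
    A d d' ≠ 0 := by
  obtain ⟨c, σ, -, -, h, -⟩ := h
  obtain ⟨i, hi⟩ := c.exists_fst_eq hu
  exact h i d d' (hd.trans hi) (hd'.trans hi) hne

theorem SolvesCycleEquations.edge_ne_zero (hA : ∀ a b, A b a = -A a b)
    (h : SolvesCycleEquations ord A γ) {d : G.Dart} (hd : dartEdge d ∈ γ) : A d d.symm ≠ 0 := by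
  obtain ⟨c, σ, -, h, -⟩ := h
  rw [← c.edges] at hd
  obtain ⟨j, hj⟩ := hd
  rcases dartEdge_eq_iff.1 hj.symm with e | e
  · rw [e]
    exact h j
  · rw [e, SimpleGraph.Dart.symm_symm, hA]
    exact neg_ne_zero.2 (h j)

/-- Exchanging the two darts of the cycle, or the two lateral ones, preserves this identity up to
rearrangement. Neither the direction of the cycle nor the even permutation matters any more. -/
theorem SolvesCycleEquations.site (hA : ∀ a b, A b a = -A a b)
    (h : SolvesCycleEquations ord A γ) {u w y z : G.Dart} (hu : dartEdge u ∈ γ)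
    (hw : dartEdge w ∈ γ) (huw : u ≠ w) (fw : w.fst = u.fst) (fy : y.fst = u.fst)
    (fz : z.fst = u.fst) (hyu : y ≠ u) (hyw : y ≠ w) (hzu : z ≠ u) (hzw : z ≠ w) (hyz : y ≠ z) :
    A u y * A w z = A u z * A w y := by
  obtain ⟨c, σ, hσ, -, -, h, -⟩ := h
  obtain ⟨i, hi⟩ := c.exists_fst_eq hu
  have hs := h i
  obtain ⟨-, h0, h3⟩ := hσ i
  simp only [siteS, siteSbar, siteT, siteTbar, siteEntry] at hs
  have key : ∀ u w, u ≠ w → u = (c.dart (i - 1)).symm → w = c.dart i →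
      y ≠ u → y ≠ w → z ≠ u → z ≠ w → A u y * A w z = A u z * A w y := by
    rintro u w - rfl rfl hyu hyw hzu hzw
    rw [h0, h3] at hs
    rw [← h0] at hyu hzu
    rw [← h3] at hyw hzw
    rcases eq_or_eq_of_site ord (σ i) (fy.trans hi) hyu hyw with e1 | e1 <;>
      rcases eq_or_eq_of_site ord (σ i) (fz.trans hi) hzu hzw with e2 | e2
    · exact absurd (e1.trans e2.symm) hyz
    · rw [← e1, ← e2, hA (c.dart i) z] at hs
      linear_combination -hs
    · rw [← e1, ← e2, hA (c.dart i) y] at hs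
      linear_combination hs
    · exact absurd (e1.trans e2.symm) hyz
  rcases c.eq_or_eq hu hi with eu | eu <;> rcases c.eq_or_eq hw (fw.trans hi) with ew | ew
  · exact absurd (eu.trans ew.symm) huw
  · have := key w u huw.symm ew eu hyw hyu hzw hzu
    linear_combination -this
  · exact key u w huw eu ew hyu hyw hzu hzw
  · exact absurd (eu.trans ew.symm) huw

/-- By `site`, the ratio of `A d y` to `A u y` is the same for both lateral darts, so the darts `y`
and `y'` may be chosen freely at the two ends. -/
theorem SolvesCycleEquations.edge (hA : ∀ a b, A b a = -A a b)
    (h : SolvesCycleEquations ord A γ) {d u u' y y' : G.Dart} (hd : dartEdge d ∈ γ)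
    (hu : dartEdge u ∈ γ) (hu' : dartEdge u' ∈ γ) (fu : u.fst = d.fst) (fu' : u'.fst = d.snd)
    (hud : u ≠ d) (hud' : u' ≠ d.symm) (fy : y.fst = d.fst) (fy' : y'.fst = d.snd)
    (hyd : y ≠ d) (hyu : y ≠ u) (hyd' : y' ≠ d.symm) (hyu' : y' ≠ u') :
    A d d.symm ^ 2 * (A u y * A u' y') =
      -(A u d * A d y * (A u' d.symm * A d.symm y')) := by
  have hsol := h
  obtain ⟨c, σ, hσ, -, -, -, h, -⟩ := h
  have key : ∀ i u u' y y', dartEdge u ∈ γ → dartEdge u' ∈ γ → u.fst = (c.dart i).fst →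
      u'.fst = (c.dart i).snd → u ≠ c.dart i → u' ≠ (c.dart i).symm → y.fst = (c.dart i).fst →
      y'.fst = (c.dart i).snd → y ≠ c.dart i → y ≠ u → y' ≠ (c.dart i).symm → y' ≠ u' →
      A (c.dart i) (c.dart i).symm ^ 2 * (A u y * A u' y') =
        -(A u (c.dart i) * A (c.dart i) y *
          (A u' (c.dart i).symm * A (c.dart i).symm y')) := by
    intro i u u' y y' hu hu' fu fu' hud hud' fy fy' hyd hyu hyd' hyu'
    have hdi : dartEdge (c.dart i) ∈ γ := c.edges.subset ⟨i, rfl⟩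
    have hdi' : dartEdge (c.dart i).symm ∈ γ := by rwa [dartEdge_symm]
    have hs := h i
    simp only [siteS, siteSbar, siteT, siteTbar, siteU, siteEntry] at hs
    obtain ⟨-, h0, h3⟩ := hσ i
    obtain ⟨-, h0', h3'⟩ := hσ (i + 1)
    rw [add_sub_cancel_right] at h0'
    have eu : u = (c.dart (i - 1)).symm := (c.eq_or_eq hu fu).resolve_left hud
    have eu' : u' = c.dart (i + 1) := by
      have := c.eq_or_eq hu' (fu'.trans (c.snd_eq i))
      rw [add_sub_cancel_right] at this
      exact this.resolve_right hud'
    rw [h0, h3, h0', h3'] at hs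
    have hx : ∀ x : G.Dart, x = ord (c.dart i).fst (σ i 1) → x.fst = (c.dart i).fst ∧ x ≠ u ∧
        x ≠ c.dart i := by
      rintro x rfl
      refine ⟨ord_fst .., fun e => ?_, fun e => ?_⟩
      · rw [eu, ← h0] at e
        exact absurd ((σ i).injective (ord_inj ord e).2) (by decide)
      · rw [← h3] at e
        exact absurd ((σ i).injective (ord_inj ord e).2) (by decide)
    have hx' : ∀ x : G.Dart, x = ord (c.dart (i + 1)).fst (σ (i + 1) 2) →
        x.fst = (c.dart i).snd ∧ x ≠ u' ∧ x ≠ (c.dart i).symm := by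
      rintro x rfl
      refine ⟨(ord_fst ..).trans (c.snd_eq i).symm, fun e => ?_, fun e => ?_⟩
      · rw [eu', ← h3'] at e
        exact absurd ((σ (i + 1)).injective (ord_inj ord e).2) (by decide)
      · rw [← h0'] at e
        exact absurd ((σ (i + 1)).injective (ord_inj ord e).2) (by decide)
    generalize hxe : (ord (c.dart i).fst (σ i 1) : G.Dart) = x at hs
    generalize hxe' : (ord (c.dart (i + 1)).fst (σ (i + 1) 2) : G.Dart) = x' at hs
    rw [← eu, ← eu'] at hs
    obtain ⟨fx, hxu, hxd⟩ := hx x hxe.symm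
    obtain ⟨fx', hxu', hxd'⟩ := hx' x' hxe'.symm
    have n1 : A u x ≠ 0 := hsol.ne_zero hu rfl (fx.trans fu.symm) hxu.symm
    have n2 : A u' x' ≠ 0 := hsol.ne_zero hu' rfl (fx'.trans fu'.symm) hxu'.symm
    have e1 : A u x * A (c.dart i) y = A u y * A (c.dart i) x := by
      by_cases hxy : x = y
      · rw [hxy]
      · exact hsol.site hA hu hdi hud fu.symm (fx.trans fu.symm) (fy.trans fu.symm) hxu hxd hyu hyd
          hxy
    have e2 : A u' x' * A (c.dart i).symm y' = A u' y' * A (c.dart i).symm x' := by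
      by_cases hxy : x' = y'
      · rw [hxy]
      · exact hsol.site hA hu' hdi' hud' fu'.symm (fx'.trans fu'.symm) (fy'.trans fu'.symm) hxu'
          hxd' hyu' hyd' hxy
    rw [hs, hA u' (c.dart i).symm, hA u' x']
    field_simp
    linear_combination (A u (c.dart i) * A (c.dart i) y * A u x * A u' (c.dart i).symm) * e2 +
      (A u (c.dart i) * A u' (c.dart i).symm * A u' y' * A (c.dart i).symm x') * e1
  have hd2 := hd
  rw [← c.edges] at hd2
  obtain ⟨i, hi⟩ := hd2
  rcases dartEdge_eq_iff.1 hi.symm with e | e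
  · subst e
    exact key i u u' y y' hu hu' fu fu' hud hud' fy fy' hyd hyu hyd' hyu'
  · subst e
    have h2 := key i u' u y' y hu' hu fu' fu
      (by simpa using hud') hud fy' fy (by simpa using hyd') hyu' hyd hyu
    rw [SimpleGraph.Dart.symm_symm, hA (c.dart i)]
    linear_combination h2

end CycleEquations

/-! ### Real solutions force orientability -/

namespace EmbeddingScheme

variable {V : Type*} {G : SimpleGraph V} {X : EmbeddingScheme G}

/-- A face has only two darts at each of its vertices. -/
theorem eq_or_eq_or_eq_of_mem_faceBoundary [Finite V] (hX : X.IsStrong) {idx : G.Dart → ZMod 4}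
    (hidx : X.IsNumbering idx) {x : G.Dart × ℤˣ} {a b c : G.Dart} (hb : b.fst = a.fst)
    (hc : c.fst = a.fst) (ha' : dartEdge a ∈ X.faceBoundary x)
    (hb' : dartEdge b ∈ X.faceBoundary x) (hc' : dartEdge c ∈ X.faceBoundary x) :
    a = b ∨ a = c ∨ b = c := by
  obtain ⟨n, _, Z, t, -, hZ, -⟩ := exists_siteCycle hX hidx x
  rw [← hZ, Z.mem_edges_iff] at ha' hb' hc'
  obtain ⟨i, hi⟩ := ha'
  obtain ⟨j, hj⟩ := hb'
  obtain ⟨k, hk⟩ := hc'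
  have hfst : ∀ {i x}, (x = Z.d i ∨ x = Z.p i) → x.fst = (Z.d i).fst := by
    rintro i x (rfl | rfl)
    exacts [rfl, Z.fst_p i]
  have e1 : j = i := Z.idx (by rw [← hfst hj, ← hfst hi, hb])
  have e2 : k = i := Z.idx (by rw [← hfst hk, ← hfst hi, hc])
  subst e1 e2
  rcases hi with rfl | rfl <;> rcases hj with rfl | rfl <;> rcases hk with rfl | rfl <;> simp

/-- The rotation, reversed at the vertices with `ε = -1`. -/
def rotAt (X : EmbeddingScheme G) (ε : V → ℤˣ) : Equiv.Perm G.Dart where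
  toFun d := (X.rot ^ (ε d.fst : ℤ)) d
  invFun d := (X.rot ^ (-(ε d.fst : ℤ))) d
  left_inv d := by
    simp only [X.fst_rot_zpow]
    rw [← Equiv.Perm.mul_apply, ← zpow_add, neg_add_cancel, zpow_zero, Equiv.Perm.one_apply]
  right_inv d := by
    have : ((X.rot ^ (-(ε d.fst : ℤ))) d).fst = d.fst := by
      simpa using X.fst_rot_zpow (-ε d.fst) d
    simp only [this]
    rw [← Equiv.Perm.mul_apply, ← zpow_add, add_neg_cancel, zpow_zero, Equiv.Perm.one_apply]

theorem rotAt_apply (X : EmbeddingScheme G) (ε : V → ℤˣ) (d : G.Dart) :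
    X.rotAt ε d = (X.rot ^ (ε d.fst : ℤ)) d := rfl

/-- Reversal of the rotation at the vertices with `ε = -1`, with trivial signature. -/
def reverseAt (X : EmbeddingScheme G) (ε : V → ℤˣ) : EmbeddingScheme G where
  rot := X.rotAt ε
  fst_rot d := X.fst_rot_zpow _ _
  sameCycle_rot d d' h := by
    have hinv : ∀ x, (X.rotAt ε).SameCycle d (X.rot x) = (X.rotAt ε).SameCycle d x := fun x => by
      rcases Int.units_eq_one_or (ε x.fst) with hε | hε
      · have : X.rot x = X.rotAt ε x := by rw [rotAt_apply, hε]; simp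
        rw [this, Equiv.Perm.sameCycle_apply_right]
      · have : X.rotAt ε (X.rot x) = x := by rw [rotAt_apply, X.fst_rot, hε]; simp
        rw [← Equiv.Perm.sameCycle_apply_right, this]
    rw [← X.eq_of_rot_invariant (fun x => (X.rotAt ε).SameCycle d x) hinv h]
  sgn _ := 1

theorem orientable_of_sgn_eq (ε : V → ℤˣ)
    (h : ∀ d : G.Dart, X.sgn (dartEdge d) = ε d.fst * ε d.snd) : X.Orientable := by
  refine ⟨X.reverseAt ε, ⟨ε, fun d => rfl, fun d => ?_⟩, fun e => rfl⟩
  rw [h]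
  change 1 = _
  calc (1 : ℤˣ) = ε d.fst * ε d.fst * (ε d.snd * ε d.snd) := by simp [Int.units_mul_self]
    _ = _ := by ac_rfl

/-- The sign of this quantity is the orientation at the vertex of `d` determined by `a`. -/
def cornerSign (X : EmbeddingScheme G) (a : G.Dart → G.Dart → ℝ) (d : G.Dart) : ℝ :=
  a (X.rot.symm d) d * a d (X.rot d) * a (X.rot.symm d) (X.rot d)

/-- Reversing the sense changes the sign of each of the three antisymmetric factors. -/
theorem cornerSign_zpow {a : G.Dart → G.Dart → ℝ} (ha : ∀ d d', a d' d = -a d d') (s : ℤˣ)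
    (d : G.Dart) : a ((X.rot ^ (-(s : ℤ))) d) d * a d ((X.rot ^ (s : ℤ)) d) *
      a ((X.rot ^ (-(s : ℤ))) d) ((X.rot ^ (s : ℤ)) d) = ((s : ℤ) : ℝ) * X.cornerSign a d := by
  rcases Int.units_eq_one_or s with rfl | rfl
  · simp [cornerSign]
  · simp only [Units.val_neg, Units.val_one, neg_neg, zpow_one, zpow_neg, Equiv.Perm.inv_def,
      cornerSign, Int.cast_neg, Int.cast_one]
    rw [ha d (X.rot d), ha (X.rot.symm d) d, ha (X.rot.symm d) (X.rot d)]
    ring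

theorem orientable_of_real [Fintype V] [DecidableEq V] [DecidableRel G.Adj]
    (hconn : G.Connected) (hreg : G.IsRegularOfDegree 4) (hX : X.IsStrong) (ord : SiteOrder G)
    {Fs : Set (Set G.edgeSet)} (hFs : IsMaximalFree X.faceBoundaries Fs)
    {A : Matrix G.Dart G.Dart ℂ} (hA : IsIncidenceMatrix G A) (him : ∀ d d', (A d d').im = 0)
    (hsol : ∀ γ ∈ Fs, SolvesCycleEquations ord A γ) : X.Orientable := by
  classical
  obtain ⟨idx, hidx⟩ := X.exists_numbering hreg
  have hanti : ∀ d d', A d' d = -A d d' := fun d d' => congrFun (congrFun hA.antisymm d) d'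
  let a : G.Dart → G.Dart → ℝ := fun d d' => (A d d').re
  have hcast : ∀ d d', A d d' = (a d d' : ℂ) := fun d d' =>
    Complex.ext rfl (him d d')
  have ha : ∀ d d', a d' d = -a d d' := fun d d' => by
    have := hanti d d'
    simp only [hcast] at this
    exact_mod_cast this
  have hne0 : ∀ {d d'}, A d d' ≠ 0 → a d d' ≠ 0 := fun {d d'} h h0 => h (by rw [hcast, h0]; rfl)
  have hfst : ∀ d, (X.rot d).fst = d.fst := X.fst_rot
  have hnum : ∀ k : ZMod 4, k ≠ k + 1 ∧ k ≠ k + 1 + 1 ∧ k ≠ k + 1 + 1 + 1 := by decide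
  have hd1 : ∀ d, d ≠ X.rot d := fun d h => by
    have := hidx.rot d
    rw [← h] at this
    exact (hnum _).1 this
  have hd2 : ∀ d, d ≠ X.rot (X.rot d) := fun d h => by
    have := hidx.rot (X.rot d)
    rw [← h, hidx.rot] at this
    exact (hnum _).2.1 this
  have hd3 : ∀ d, d ≠ X.rot (X.rot (X.rot d)) := fun d h => by
    have := hidx.rot (X.rot (X.rot d))
    rw [← h, hidx.rot, hidx.rot] at this
    exact (hnum _).2.2 this
  -- the orientations at consecutive darts agree
  have hcorner : ∀ f, (∀ x y, x.fst = f.fst → y.fst = f.fst → x ≠ y → a x y ≠ 0) ∧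
      a f (X.rot f) * a (X.rot (X.rot f)) (X.rot (X.rot (X.rot f))) =
        a f (X.rot (X.rot f)) * a (X.rot f) (X.rot (X.rot (X.rot f))) := by
    intro f
    set g := X.rot f with hg
    set h := X.rot g with hh
    set k := X.rot h with hk
    have fg : g.fst = f.fst := hfst f
    have fh : h.fst = f.fst := (hfst g).trans fg
    have fk : k.fst = f.fst := (hfst h).trans fh
    have n12 : f ≠ g := hd1 f
    have n13 : f ≠ h := hd2 f
    have n14 : f ≠ k := hd3 f
    have n23 : g ≠ h := hd1 g
    have n24 : g ≠ k := hd2 g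
    have n34 : h ≠ k := hd1 h
    have hkf : X.rot k = f := by
      refine hidx.inj _ _ ((hfst k).trans fk) ?_
      rw [hidx.rot, hk, hidx.rot, hh, hidx.rot, hg, hidx.rot]
      generalize idx f = z
      revert z
      decide
    -- The faces of `(h, 1)` and `(f, 1)` lie at opposite corners, between `g`, `h` and between `k`,
    -- `f`. At least one of them is in `Fs`, and the site equation of either gives the same
    -- identity.
    have m1 : dartEdge g ∈ X.faceBoundary (h, 1) := by
      simpa [hh] using X.mem_faceBoundary_prev h 1
    have m2 : dartEdge h ∈ X.faceBoundary (h, 1) := X.mem_faceBoundary_self (h, 1)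
    have m3 : dartEdge k ∈ X.faceBoundary (f, 1) := by
      have := X.mem_faceBoundary_prev f 1
      rw [← hkf] at this ⊢
      simpa using this
    have m4 : dartEdge f ∈ X.faceBoundary (f, 1) := X.mem_faceBoundary_self (f, 1)
    have hFne : X.faceBoundary (h, 1) ≠ X.faceBoundary (f, 1) := by
      intro e
      rw [← e] at m4
      rcases eq_or_eq_or_eq_of_mem_faceBoundary hX hidx fg fh m4 m1 m2 with e | e | e
      exacts [n12 e, n13 e, n23 e]
    rcases mem_or_mem_of_isMaximalFree hconn hX hidx hFs ⟨_, rfl⟩ ⟨_, rfl⟩ hFne with hF | hF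
    · have hs := hsol _ hF
      refine ⟨fun x y hx hy hxy => hne0 (hs.ne_zero m1 (hx.trans fg.symm) (hy.trans fg.symm) hxy),
        ?_⟩
      have := hs.site hanti m1 m2 n23 (fh.trans fg.symm) fg.symm (fk.trans fg.symm) n12 n13
        n24.symm n34.symm n14
      simp only [hcast] at this
      norm_cast at this
      rw [ha f g, ha f h] at this
      linear_combination -this
    · have hs := hsol _ hF
      refine ⟨fun x y hx hy hxy => hne0 (hs.ne_zero m4 hx hy hxy), ?_⟩
      have := hs.site hanti m4 m3 n14 fk fg fh n12.symm n24 n13.symm n34 n23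
      simp only [hcast] at this
      norm_cast at this
      rw [ha h k, ha g k] at this
      linear_combination -this
  have hpos : ∀ d, 0 < X.cornerSign a d * X.cornerSign a (X.rot d) := by
    intro d
    obtain ⟨f, rfl⟩ := X.rot.surjective d
    obtain ⟨h0, h1⟩ := hcorner f
    have fg := hfst f
    have fh := (hfst (X.rot f)).trans fg
    have n12 := h0 _ _ rfl fg (hd1 f)
    have n23 := h0 _ _ fg fh (hd1 _)
    have n34 := h0 _ _ fh ((hfst _).trans fh) (hd1 _)
    simp only [cornerSign, Equiv.symm_apply_apply]
    -- By the identity at this vertex, the product of consecutive corner signs is a square, nonzero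
    -- because the entries are.
    have : a f (X.rot f) * a (X.rot f) (X.rot (X.rot f)) * a f (X.rot (X.rot f)) *
        (a (X.rot f) (X.rot (X.rot f)) * a (X.rot (X.rot f)) (X.rot (X.rot (X.rot f))) *
          a (X.rot f) (X.rot (X.rot (X.rot f)))) = (a (X.rot f) (X.rot (X.rot f)) *
          (a f (X.rot f) * a (X.rot (X.rot f)) (X.rot (X.rot (X.rot f))))) ^ 2 := by
      linear_combination -(a (X.rot f) (X.rot (X.rot f)) ^ 2 *
        (a f (X.rot f) * a (X.rot (X.rot f)) (X.rot (X.rot (X.rot f))))) * h1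
    rw [this]
    positivity
  let e : G.Dart → ℤˣ := fun d => if 0 < X.cornerSign a d then 1 else -1
  have he : ∀ d, e (X.rot d) = e d := fun d => by
    have : 0 < X.cornerSign a (X.rot d) ↔ 0 < X.cornerSign a d :=
      (pos_iff_pos_of_mul_pos (hpos d)).symm
    simp only [e, this]
  -- `e` is constant on the darts of a vertex, so it descends to vertices. The default 1 concerns
  -- vertices without darts, which 4-regularity excludes.
  let ε : V → ℤˣ := fun v => if h : ∃ d : G.Dart, d.fst = v then e h.choose else 1
  have hε : ∀ d : G.Dart, ε d.fst = e d := fun d => by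
    have h : ∃ d' : G.Dart, d'.fst = d.fst := ⟨d, rfl⟩
    simp only [ε, dif_pos h]
    exact X.eq_of_rot_invariant e he h.choose_spec
  refine orientable_of_sgn_eq ε fun d => ?_
  rw [hε, show d.snd = d.symm.fst from rfl, hε]
  obtain ⟨s, hs⟩ : ∃ s, X.faceBoundary (d, s) ∈ Fs := by
    rcases mem_or_mem_of_isMaximalFree hconn hX hidx hFs ⟨_, rfl⟩ ⟨_, rfl⟩
      (faceBoundary_ne hX hidx d) with h | h
    exacts [⟨_, h⟩, ⟨_, h⟩]
  have hS := hsol _ hs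
  set t : ℤˣ := s * X.sgn (dartEdge d) with ht
  have md : dartEdge d ∈ X.faceBoundary (d, s) := X.mem_faceBoundary_self (d, s)
  have mu : dartEdge ((X.rot ^ (-(s : ℤ))) d) ∈ X.faceBoundary (d, s) :=
    X.mem_faceBoundary_prev d s
  have mu' : dartEdge ((X.rot ^ (t : ℤ)) d.symm) ∈ X.faceBoundary (d, s) := by
    rw [← faceBoundary_faceStep]
    exact X.mem_faceBoundary_self _
  have hrot1 : ∀ (s : ℤˣ) d, (X.rot ^ (s : ℤ)) d ≠ d := fun s d h => by
    have := hidx.zpow s d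
    rw [h] at this
    rcases Int.units_eq_one_or s with rfl | rfl
    · exact (hnum (idx d)).1 (by simpa using this)
    · exact absurd (show (1 : ZMod 4) = 0 by simpa using this) (by decide)
  have hrot2 : ∀ (s : ℤˣ) d, (X.rot ^ (s : ℤ)) d ≠ (X.rot ^ ((-s : ℤˣ) : ℤ)) d := fun s d h => by
    have h1 := hidx.zpow s d
    rw [h, hidx.zpow] at h1
    have : ∀ k : ZMod 4, k + -1 ≠ k + 1 := by decide
    rcases Int.units_eq_one_or s with rfl | rfl
    · exact this (idx d) (by simpa using h1)
    · exact this (idx d) (by simpa using h1.symm)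
  have hneg : ∀ s : ℤˣ, -(s : ℤ) = ((-s : ℤˣ) : ℤ) := fun s => (Units.val_neg s).symm
  -- With these `y` and `y'`, the two triples are the corner at `d` in the sense `s` and the corner
  -- at `d.symm` in the sense `-t`.
  have hE := hS.edge hanti (y := (X.rot ^ (s : ℤ)) d) (y' := (X.rot ^ (-(t : ℤ))) d.symm) md mu mu'
    (by rw [hneg]; exact X.fst_rot_zpow _ _) (X.fst_rot_zpow _ _)
    (by rw [hneg]; exact hrot1 _ _) (hrot1 _ _) (X.fst_rot_zpow _ _)
    (by rw [hneg]; exact X.fst_rot_zpow _ _) (hrot1 _ _) (by rw [hneg]; exact hrot2 _ _)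
    (by rw [hneg]; exact hrot1 _ _) (by rw [hneg]; exact (hrot2 _ _).symm)
  have hB := hne0 (hS.edge_ne_zero hanti md)
  simp only [hcast] at hE
  norm_cast at hE
  simp only [← hneg] at hE
  have w1 := cornerSign_zpow (X := X) ha s d
  have w2 := cornerSign_zpow (X := X) ha (-t) d.symm
  rw [hneg, neg_neg, ← hneg] at w2
  have n1 : a ((X.rot ^ (-(s : ℤ))) d) ((X.rot ^ (s : ℤ)) d) ≠ 0 :=
    (hcorner d).1 _ _ (by rw [hneg]; exact X.fst_rot_zpow _ _) (X.fst_rot_zpow _ _)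
      (by rw [hneg]; exact (hrot2 _ _).symm)
  have n2 : a ((X.rot ^ (t : ℤ)) d.symm) ((X.rot ^ (-(t : ℤ))) d.symm) ≠ 0 :=
    (hcorner d.symm).1 _ _ (X.fst_rot_zpow _ _) (by rw [hneg]; exact X.fst_rot_zpow _ _)
      (by rw [hneg]; exact hrot2 _ _)
  -- Multiplying the edge equation by the two outer entries makes its left side a positive square.
  -- The right side becomes `s * t` times the two corner signs, and `s * t` is the signature.
  have hsign : 0 < ((X.sgn (dartEdge d) : ℤ) : ℝ) * (X.cornerSign a d * X.cornerSign a d.symm) := by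
    have hst : ((s : ℤ) : ℝ) * ((t : ℤ) : ℝ) = ((X.sgn (dartEdge d) : ℤ) : ℝ) := by
      have : s * t = X.sgn (dartEdge d) := by rw [ht, ← mul_assoc, Int.units_mul_self, one_mul]
      rw [← this]
      push_cast
      rfl
    have hsq : 0 < (a d d.symm * (a ((X.rot ^ (-(s : ℤ))) d) ((X.rot ^ (s : ℤ)) d) *
      a ((X.rot ^ (t : ℤ)) d.symm) ((X.rot ^ (-(t : ℤ))) d.symm))) ^ 2 := by positivity
    refine hsq.trans_eq ?_
    rw [mul_pow, pow_two (_ * _), ← mul_assoc, hE, ← hst]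
    push_cast at w2
    calc _ = -((a ((X.rot ^ (-(s : ℤ))) d) d * a d ((X.rot ^ (s : ℤ)) d) *
          a ((X.rot ^ (-(s : ℤ))) d) ((X.rot ^ (s : ℤ)) d)) *
          (a ((X.rot ^ (t : ℤ)) d.symm) d.symm * a d.symm ((X.rot ^ (-(t : ℤ))) d.symm) *
          a ((X.rot ^ (t : ℤ)) d.symm) ((X.rot ^ (-(t : ℤ))) d.symm))) := by ring
      _ = _ := by rw [w1, w2]; ring
  have hprod : 0 < X.cornerSign a d * X.cornerSign a d.symm ∨
      X.cornerSign a d * X.cornerSign a d.symm < 0 := by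
    rcases lt_trichotomy (X.cornerSign a d * X.cornerSign a d.symm) 0 with h | h | h
    · exact Or.inr h
    · rw [h] at hsign
      simp at hsign
    · exact Or.inl h
  rcases Int.units_eq_one_or (X.sgn (dartEdge d)) with hl | hl <;> rw [hl] at hsign ⊢
  · simp only [Units.val_one, Int.cast_one, one_mul] at hsign
    have : 0 < X.cornerSign a d ↔ 0 < X.cornerSign a d.symm := pos_iff_pos_of_mul_pos hsign
    simp only [e, this]
    exact (Int.units_mul_self _).symm
  · have hneg' : X.cornerSign a d * X.cornerSign a d.symm < 0 := by
      simpa using hsign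
    simp only [e]
    rcases mul_neg_iff.1 hneg' with ⟨h1, h2⟩ | ⟨h1, h2⟩
    · rw [if_pos h1, if_neg h2.le.not_gt]; rfl
    · rw [if_neg h1.le.not_gt, if_pos h2]; rfl

end EmbeddingScheme

/-! ### The two parts of the lemma -/

theorem lemma3p10 {V : Type*} [Fintype V] [DecidableEq V] (G : SimpleGraph V)
    [DecidableRel G.Adj] (hconn : G.Connected) (hreg : G.IsRegularOfDegree 4)
    (X : EmbeddingScheme G) (hX : X.IsStrong) (ord : SiteOrder G)
    (Fs : Set (Set G.edgeSet)) (hFs : IsMaximalFree X.faceBoundaries Fs) :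
    (∃ A : Matrix G.Dart G.Dart ℂ, IsIncidenceMatrix G A ∧
      (∀ d d' : G.Dart,
        if d.edge = d'.edge ∧ X.sgn (dartEdge d) = -1 then (A d d').re = 0
        else (A d d').im = 0) ∧
      (∀ γ ∈ Fs, SolvesCycleEquations ord A γ) ∧
      (∀ C, IsClosedCurve G C → ∀ γ ∈ Fs,
        curveWeight ord A (refMatching ord) C =
          curveWeight ord A (refMatching ord) (symmDiff C γ))) ∧
    ((∃ A : Matrix G.Dart G.Dart ℂ, IsIncidenceMatrix G A ∧
      (∀ d d' : G.Dart, (A d d').im = 0) ∧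
      (∀ γ ∈ Fs, SolvesCycleEquations ord A γ) ∧
      (∀ C, IsClosedCurve G C → ∀ γ ∈ Fs,
        curveWeight ord A (refMatching ord) C =
          curveWeight ord A (refMatching ord) (symmDiff C γ))) ↔ X.Orientable) := by
  refine ⟨?_, ?_, ?_⟩
  · obtain ⟨A, h1, h2, h3⟩ :=
      EmbeddingScheme.exists_incidenceMatrix hreg hX ord (fun _ => 1) hFs.prop.1 hFs.prop.2
    simp only [EmbeddingScheme.twist, one_mul, mul_one] at h2
    exact ⟨A, h1, h2, h3⟩
  · rintro ⟨A, h1, h2, h3, -⟩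
    exact EmbeddingScheme.orientable_of_real hconn hreg hX ord hFs h1 h2 h3
  · rintro ⟨Y, ⟨ε, -, hε⟩, hY⟩
    obtain ⟨A, h1, h2, h3⟩ :=
      EmbeddingScheme.exists_incidenceMatrix hreg hX ord ε hFs.prop.1 hFs.prop.2
    refine ⟨A, h1, fun d d' => ?_, h3⟩
    -- The twisted signature is the signature of the equivalent scheme `Y`, which is trivial.
    have htw : X.twist ε d = 1 := (hε d).symm.trans (hY _)
    have := h2 d d'
    rw [htw, if_neg (by rintro ⟨-, h⟩; exact absurd h (by decide))] at this
    exact this
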